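/- Let $I\subseteq\mathbb R$ be an interval (bounded or not) and let $\mathfrak F=\bigoplus_{n\ge 0}L^2_{\mathrm{sym}}(I^n)$ be the bosonic Fock space over $L^2(I)$, with vacuum $|\Omega\rangle$ and field operators $(\psi(x)\varphi)_n(y_1,\dots,y_n)=\sqrt{n+1}\,\varphi_{n+1}(x,y_1,\dots,y_n)$; expressions in $\psi^\dagger(x),\psi(x)$ are understood through their matrix elements. Define the supermaps $l_x[A]=\psi^\dagger(x)A$, $r_x[A]=A\psi(x)$, $\mathrm{Ad}_x[A]=\psi^\dagger(x)A\psi(x)$. Write $\int D^nx$ for integration over $\{x_1>\dots>x_n\}\subseteq I^n$. For $B\in M_D(\mathbb C)$ and functions $Q,L,R,T:I\to M_D(\mathbb C)$ let $\mathfrak L_x=Q(x)\otimes\mathrm{Id}+L(x)\otimes l_x+R(x)\otimes r_x+T(x)\otimes\mathrm{Ad}_x$. A bounded operator $O$ on $\mathfrak F$ is the cMPO with bond dimension $D$ and tensors $B,Q,L,R,T$ if $$O=\mathrm{Tr}_D\big(B\,\mathcal P e^{\int_I dx\,\mathfrak L_x}\big)(|\Omega\rangle\langle\Omega|)=\sum_{n\ge0}\int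 D^nx\,\mathrm{Tr}_D\big((B\otimes\mathrm{Id})\,\mathfrak L_{x_1}\cdots\mathfrak L_{x_n}\big)(|\Omega\rangle\langle\Omega|),$$ where the matrix elements of the terms between vectors with finitely many particles are integrable and the resulting series converge to those of $O$. A cMPU is a unitary cMPO. (a) $\mathcal P e^{\int_I dx\,\mathrm{Ad}_x}[|\Omega\rangle\langle\Omega|]=\sum_{n\ge0}\int D^nx\,\psi^\dagger(x_1)\cdots\psi^\dagger(x_n)|\Omega\rangle\langle\Omega|\psi(x_n)\cdots\psi(x_1)=\mathbb 1$: the $n$-th term is a bounded operator (a weak integral on all of $\mathfrak F$), and the series converges strongly to the identity; its matrix elements between vectors with finitely many particles converge as well. Consequently $\mathbb 1$ is a cMPU with $D=1$, $B=T=1$ and $Q=L=R=0$. (b) For every $\alpha\in L^2(I)$ there is exactly one bounded operator $D(\alpha)=\exp\int_I dx\,(\alpha(x)\psi^\dagger(x)-\alpha^*(x)\psi(x))$ on $\mathfrak F$, that is, one given on vectors with finitely many particles by the strongly convergent exponential series. It is a cMPU with $D=1$, $B=T=1$, $Q(x)=-\tfrac12|\alpha(x)|^2$, $L(x)=\alpha(x)$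 and $R(x)=-\alpha^*(x)$. -/

import Mathlib

open MeasureTheory
open scoped ComplexConjugate

noncomputable section

namespace ContinuousMPO

/-! ### The bosonic Fock space over `L²(I)` -/

/-- The measure of the configuration space `Iⁿ` of `n` particles. -/
abbrev configMeasure (I : Set ℝ) (n : ℕ) : Measure (Fin n → ℝ) :=
  Measure.pi fun _ => volume.restrict I

theorem measurePreserving_perm (I : Set ℝ) (n : ℕ) (σ : Equiv.Perm (Fin n)) :
    MeasurePreserving (fun x : Fin n → ℝ => x ∘ σ) (configMeasure I n) (configMeasure I n) := by
  have h := measurePreserving_piCongrLeft (fun _ : Fin n => volume.restrict I) σ.symm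
  have h2 : (fun x : Fin n → ℝ => x ∘ σ) =
      MeasurableEquiv.piCongrLeft (fun _ : Fin n => ℝ) σ.symm := by
    funext x
    funext i
    have := MeasurableEquiv.piCongrLeft_apply_apply (β := fun _ : Fin n => ℝ) σ.symm x (σ i)
    simpa using this.symm
  rw [h2]
  exact h

/-- The exchange of particles `f ↦ f (x ∘ σ)` on `L²(Iⁿ)`. -/
def exchange (I : Set ℝ) (n : ℕ) (σ : Equiv.Perm (Fin n)) :
    Lp ℂ 2 (configMeasure I n) →ₗᵢ[ℂ] Lp ℂ 2 (configMeasure I n) :=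
  Lp.compMeasurePreservingₗᵢ ℂ (fun x : Fin n → ℝ => x ∘ σ) (measurePreserving_perm I n σ)

/-- The `n`-particle sector: the permutation-symmetric functions in `L²(Iⁿ)`. -/
def sector (I : Set ℝ) (n : ℕ) : Submodule ℂ (Lp ℂ 2 (configMeasure I n)) where
  carrier := {f | ∀ σ : Equiv.Perm (Fin n), exchange I n σ f = f}
  add_mem' hf hg σ := by rw [map_add, hf σ, hg σ]
  zero_mem' σ := map_zero _
  smul_mem' c f hf σ := by rw [map_smul, hf σ]

instance sector_complete (I : Set ℝ) (n : ℕ) : CompleteSpace (sector I n) := by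
  have h : IsClosed (sector I n : Set (Lp ℂ 2 (configMeasure I n))) := by
    have h2 : (sector I n : Set (Lp ℂ 2 (configMeasure I n))) =
        ⋂ σ : Equiv.Perm (Fin n), {f | exchange I n σ f = f} := by
      ext f
      simp [sector]
    rw [h2]
    exact isClosed_iInter fun σ => isClosed_eq (exchange I n σ).continuous continuous_id
  exact h.completeSpace_coe

/-- The bosonic Fock space, the Hilbert sum of all `n`-particle sectors. -/
abbrev Fock (I : Set ℝ) : Type := lp (fun n : ℕ => sector I n) 2

/-- The dense subspace of vectors with finitely many particles. -/
def finiteParticle (I : Set ℝ) : Submodule ℂ (Fock I) where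
  carrier := {φ | ∃ N : ℕ, ∀ n, N ≤ n → φ n = 0}
  add_mem' := by
    rintro φ χ ⟨N, hN⟩ ⟨M, hM⟩
    refine ⟨max N M, fun n hn => ?_⟩
    rw [lp.coeFn_add, Pi.add_apply, hN n (le_trans (le_max_left _ _) hn),
      hM n (le_trans (le_max_right _ _) hn), add_zero]
  zero_mem' := ⟨0, fun n _ => rfl⟩
  smul_mem' := by
    rintro c φ ⟨N, hN⟩
    refine ⟨N, fun n hn => ?_⟩
    rw [lp.coeFn_smul, Pi.smul_apply, hN n hn, smul_zero]

/-! ### The field operator and operators in the form sense -/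

/-- Families of `n`-particle wave functions, `n = 0, 1, 2, …`, as pointwise defined functions. -/
abbrev WaveFamily : Type := (n : ℕ) → (Fin n → ℝ) → ℂ

/-- The wave functions of a Fock vector. -/
def waves {I : Set ℝ} (φ : Fock I) : WaveFamily :=
  fun n => ((φ n : Lp ℂ 2 (configMeasure I n)) : (Fin n → ℝ) → ℂ)

/-- The annihilation operator `ψ(x)` at the point `x`:
`(ψ(x) φ)ₙ(y₁, …, yₙ) = √(n+1) φₙ₊₁(x, y₁, …, yₙ)`. -/
def ψ (x : ℝ) : WaveFamily →ₗ[ℂ] WaveFamily where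
  toFun φ := fun n y => (Real.sqrt (n + 1) : ℂ) * φ (n + 1) (Fin.cons x y)
  map_add' φ χ := by
    funext n y
    simp [mul_add]
  map_smul' c φ := by
    funext n y
    simp [mul_left_comm]

/-- Expressions in the fields `ψ†(x)`, `ψ(x)`, which are operator-valued distributions, are given
by their matrix elements `A φ χ = ⟨φ, A χ⟩`: a sesquilinear form, antilinear in `φ`. -/
abbrev FieldForm : Type := WaveFamily →ₗ⋆[ℂ] WaveFamily →ₗ[ℂ] ℂ

/-- The vacuum projector `|Ω⟩⟨Ω|`. -/
def vacuumProj : FieldForm :=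
  LinearMap.mk₂'ₛₗ (starRingEnd ℂ) (RingHom.id ℂ)
    (fun φ χ => conj (φ 0 Fin.elim0) * χ 0 Fin.elim0)
    (by intros; simp [add_mul]) (by intros; simp [mul_assoc])
    (by intros; simp [mul_add]) (by intros; simp [mul_left_comm])

/-- Supermaps: linear maps acting on field expressions. -/
abbrev Supermap : Type := Module.End ℂ FieldForm

/-- The supermap `l_x[A] = ψ†(x) A`, that is `⟨φ, ψ†(x) A χ⟩ = ⟨ψ(x) φ, A χ⟩`. -/
def lMap (x : ℝ) : Supermap where
  toFun A := A.comp (ψ x)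
  map_add' _ _ := rfl
  map_smul' _ _ := rfl

/-- The supermap `r_x[A] = A ψ(x)`. -/
def rMap (x : ℝ) : Supermap where
  toFun A := LinearMap.mk₂'ₛₗ (starRingEnd ℂ) (RingHom.id ℂ) (fun φ χ => A φ (ψ x χ))
    (by intros; simp) (by intros; simp) (by intros; simp) (by intros; simp)
  map_add' _ _ := rfl
  map_smul' _ _ := rfl

/-- The supermap `Ad_x[A] = ψ†(x) A ψ(x)`. -/
def adMap (x : ℝ) : Supermap where
  toFun A := LinearMap.mk₂'ₛₗ (starRingEnd ℂ) (RingHom.id ℂ) (fun φ χ => A (ψ x φ) (ψ x χ))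
    (by intros; simp) (by intros; simp) (by intros; simp) (by intros; simp)
  map_add' _ _ := rfl
  map_smul' _ _ := rfl

/-- `ψ(xₙ) ⋯ ψ(x₁) φ`. -/
def annihilateAll {n : ℕ} (x : Fin n → ℝ) (φ : WaveFamily) : WaveFamily :=
  (List.ofFn x).foldl (fun χ y => ψ y χ) φ

/-- `ψ†(x₁) ⋯ ψ†(xₙ) |Ω⟩⟨Ω| ψ(xₙ) ⋯ ψ(x₁)`, by its matrix elements. -/
def adVacuum {n : ℕ} (x : Fin n → ℝ) (φ χ : WaveFamily) : ℂ :=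
  vacuumProj (annihilateAll x φ) (annihilateAll x χ)

/-! ### Path-ordered exponentials -/

/-- The domain `{x₁ > x₂ > ⋯ > xₙ} ⊆ Iⁿ` of the path-ordered measure `∫ Dⁿx`. -/
def orderedDomain (I : Set ℝ) (n : ℕ) : Set (Fin n → ℝ) :=
  {x | (∀ i, x i ∈ I) ∧ StrictAnti x}

/-- The path-ordered product `S(x₁) S(x₂) ⋯ S(xₙ)`. -/
def orderedProd {A : Type*} [Monoid A] (S : ℝ → A) {n : ℕ} (x : Fin n → ℝ) : A :=
  (List.ofFn fun i => S (x i)).prod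

/-- The bounded operator `A` is the weak path-ordered integral `∫ Dⁿx G(x)`, on the domain `V`. -/
def IsOrderedIntegral (I : Set ℝ) (V : Submodule ℂ (Fock I)) {n : ℕ}
    (G : (Fin n → ℝ) → FieldForm) (A : Fock I →L[ℂ] Fock I) : Prop :=
  ∀ φ ∈ V, ∀ χ ∈ V,
    IntegrableOn (fun x => G x (waves φ) (waves χ)) (orderedDomain I n) ∧
    inner ℂ φ (A χ) = ∫ x in orderedDomain I n, G x (waves φ) (waves χ)

/-- The bounded operator `O` is the sum `∑ₙ ∫ Dⁿx Gₙ(x)`, in the sense that all matrix elements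
between vectors with finitely many particles converge to those of `O`. -/
def IsDysonSum (I : Set ℝ) (G : (n : ℕ) → (Fin n → ℝ) → FieldForm)
    (O : Fock I →L[ℂ] Fock I) : Prop :=
  ∀ φ ∈ finiteParticle I, ∀ χ ∈ finiteParticle I,
    (∀ n, IntegrableOn (fun x => G n x (waves φ) (waves χ)) (orderedDomain I n)) ∧
    HasSum (fun n => ∫ x in orderedDomain I n, G n x (waves φ) (waves χ)) (inner ℂ φ (O χ))

/-- The Dyson series of `𝒫 exp(∫ Ad_x dx)` applied to `|Ω⟩⟨Ω|`. -/
def adDyson (n : ℕ) (x : Fin n → ℝ) : FieldForm :=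
  orderedProd adMap x vacuumProj

/-! ### Continuous matrix product operators -/

/-- `M ⊗ s` for a matrix `M` on the bond space and a supermap `s`. -/
def bondTensor {D : ℕ} (M : Matrix (Fin D) (Fin D) ℂ) (s : Supermap) :
    Matrix (Fin D) (Fin D) Supermap :=
  M.map fun c => c • s

/-- `𝔏_x = Q(x) ⊗ Id + L(x) ⊗ l_x + R(x) ⊗ r_x + T(x) ⊗ Ad_x`. -/
def generator {D : ℕ} (Q L R T : ℝ → Matrix (Fin D) (Fin D) ℂ) (x : ℝ) :
    Matrix (Fin D) (Fin D) Supermap :=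
  bondTensor (Q x) 1 + bondTensor (L x) (lMap x) + bondTensor (R x) (rMap x) +
    bondTensor (T x) (adMap x)

/-- The Dyson series of `Tr_D(B 𝒫 exp(∫ 𝔏_x dx))` applied to `|Ω⟩⟨Ω|`. -/
def cmpoDyson {D : ℕ} (B : Matrix (Fin D) (Fin D) ℂ) (Q L R T : ℝ → Matrix (Fin D) (Fin D) ℂ)
    (n : ℕ) (x : Fin n → ℝ) : FieldForm :=
  Matrix.trace (bondTensor B 1 * orderedProd (generator Q L R T) x) vacuumProj

/-- `O` is the cMPO `O[B, Q, L, R, T] = Tr_D(B 𝒫 exp(∫_I 𝔏_x dx))(|Ω⟩⟨Ω|)`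
with bond dimension `D`. -/
def IsCMPO (I : Set ℝ) {D : ℕ} (B : Matrix (Fin D) (Fin D) ℂ)
    (Q L R T : ℝ → Matrix (Fin D) (Fin D) ℂ) (O : Fock I →L[ℂ] Fock I) : Prop :=
  IsDysonSum I (cmpoDyson B Q L R T) O

/-- A cMPU is a unitary cMPO. -/
def IsCMPU (I : Set ℝ) {D : ℕ} (B : Matrix (Fin D) (Fin D) ℂ)
    (Q L R T : ℝ → Matrix (Fin D) (Fin D) ℂ) (O : Fock I →L[ℂ] Fock I) : Prop :=
  IsCMPO I B Q L R T O ∧ O ∈ unitary (Fock I →L[ℂ] Fock I)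

/-! ### The displacement operator -/

/-- The Fock space inner product on the level of wave functions. -/
def waveInner (I : Set ℝ) (φ χ : WaveFamily) : ℂ :=
  ∑' n, ∫ y, conj (φ n y) * χ n y ∂(configMeasure I n)

/-- `X` is the operator `∫_I (α(x) ψ†(x) - α(x)* ψ(x)) dx` on the vectors with finitely many
particles, the integral being understood in the sense of matrix elements. -/
def IsDisplacementGenerator (I : Set ℝ) (α : ℝ → ℂ) (X : Module.End ℂ (finiteParticle I)) : Prop :=
  ∀ φ χ : finiteParticle I,
    inner ℂ (φ : Fock I) (X χ : Fock I) =
      ∫ x in I, (α x * waveInner I (ψ x (waves (φ : Fock I))) (waves (χ : Fock I)) -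
        conj (α x) * waveInner I (waves (φ : Fock I)) (ψ x (waves (χ : Fock I))))

/-- `U` is the displacement operator `exp ∫_I (α(x) ψ†(x) - α(x)* ψ(x)) dx`: the bounded operator
given on the dense subspace of vectors with finitely many particles by the exponential series. -/
def IsDisplacementOperator (I : Set ℝ) (α : ℝ → ℂ) (U : Fock I →L[ℂ] Fock I) : Prop :=
  ∃ X : Module.End ℂ (finiteParticle I), IsDisplacementGenerator I α X ∧
    ∀ φ : finiteParticle I,
      HasSum (fun k : ℕ => (k.factorial : ℂ)⁻¹ • (((X ^ k) φ : finiteParticle I) : Fock I))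
        (U (φ : Fock I))

end ContinuousMPO

end

noncomputable section

namespace ContinuousMPO

/-! ### Integration over configuration spaces -/

/-! Let `a` and `c` be annihilation and creation of a particle in the state `α`, and `s = ‖α‖²`.
Both sides of the claim are evaluated in one expansion, with terms indexed by `q, l, r, t`: the
coefficient `(-s/2)^q/q! · (-1)^r/(l! r!)` times the inner product of the `t`-particle components of
`a^l φ` and `a^r χ`.

Operator side. On vectors with finitely many particles `c - a` is skew-symmetric, raises the
particle number by at most one, and has norm `O(√N)` on vectors with fewer than `N` particles. Hence
its exponential series converges absolutely (`summable_norm_displacementGen_pow`), and a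
skew-symmetric operator with this property exponentiates to a unitary (`exists_unitary_exp`). The
relation `ac = ca + s` gives `exp(c - a) = exp(-s/2) exp(c) exp(-a)` degree by degree
(`inv_factorial_smul_pow_eq_sum`), and moving `c^l` to the left vector yields the expansion.

Dyson side. For `D = 1` the integrand is symmetric in `x₁, …, xₙ`, because the `ψ(x)` commute on
symmetric wave functions. The ordered integral is therefore `1/n!` times the integral over `Iⁿ`,
which is computed by integrating out one variable at a time: the `Q`, `L`, `R`, `T` summands of the
generator raise `q`, `l`, `r`, `t` respectively (`normalTerm_step`, `integral_dysonList`). The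
`n`-th Dyson term is the part with `q + l + r + t = n`.

The exponential series groups the same absolutely convergent sum by `2q + l + r`, so the two sums
agree (`hasSum_quadIndex`). The identity is the case `α = 0`: only `t = n` survives and the `n`-th
term is the projection onto the `n`-particle sector. -/

theorem measurePreserving_insertNth (I : Set ℝ) {n : ℕ} (i : Fin (n + 1)) :
    MeasurePreserving (fun p : ℝ × (Fin n → ℝ) => (i.insertNth p.1 p.2 : Fin (n + 1) → ℝ))
      ((volume.restrict I).prod (configMeasure I n)) (configMeasure I (n + 1)) :=
  (measurePreserving_piFinSuccAbove (fun _ => volume.restrict I) i).symm _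

theorem measurableEmbedding_insertNth {n : ℕ} (i : Fin (n + 1)) :
    MeasurableEmbedding
      (fun p : ℝ × (Fin n → ℝ) => (i.insertNth p.1 p.2 : Fin (n + 1) → ℝ)) :=
  (MeasurableEquiv.piFinSuccAbove (fun _ => ℝ) i).symm.measurableEmbedding

theorem measurePreserving_cons (I : Set ℝ) (n : ℕ) :
    MeasurePreserving (fun p : ℝ × (Fin n → ℝ) => (Fin.cons p.1 p.2 : Fin (n + 1) → ℝ))
      ((volume.restrict I).prod (configMeasure I n)) (configMeasure I (n + 1)) := by
  simpa only [Fin.insertNth_zero'] using measurePreserving_insertNth I (0 : Fin (n + 1))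

theorem measurableEmbedding_cons (n : ℕ) :
    MeasurableEmbedding
      (fun p : ℝ × (Fin n → ℝ) => (Fin.cons p.1 p.2 : Fin (n + 1) → ℝ)) := by
  simpa only [Fin.insertNth_zero'] using measurableEmbedding_insertNth (0 : Fin (n + 1))

@[fun_prop]
theorem measurable_cons {Z : Type*} [MeasurableSpace Z] {n : ℕ} {f : Z → ℝ}
    {g : Z → Fin n → ℝ} (hf : Measurable f) (hg : Measurable g) :
    Measurable fun z => (Fin.cons (f z) (g z) : Fin (n + 1) → ℝ) :=
  (measurableEmbedding_cons n).measurable.comp (hf.prodMk hg)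

theorem integrable_config_succ {I : Set ℝ} {n : ℕ} {f : (Fin (n + 1) → ℝ) → ℂ} :
    Integrable f (configMeasure I (n + 1)) ↔
      Integrable (fun p : ℝ × (Fin n → ℝ) => f (Fin.cons p.1 p.2))
        ((volume.restrict I).prod (configMeasure I n)) :=
  ((measurePreserving_cons I n).integrable_comp_emb (measurableEmbedding_cons n)).symm

theorem integral_config_succ {I : Set ℝ} {n : ℕ} (f : (Fin (n + 1) → ℝ) → ℂ) :
    ∫ x, f x ∂configMeasure I (n + 1) =
      ∫ p : ℝ × (Fin n → ℝ), f (Fin.cons p.1 p.2)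
        ∂(volume.restrict I).prod (configMeasure I n) :=
  ((measurePreserving_cons I n).integral_comp (measurableEmbedding_cons n) f).symm

theorem lintegral_config_succ {I : Set ℝ} {n : ℕ} {f : (Fin (n + 1) → ℝ) → ENNReal}
    (hf : Measurable f) :
    ∫⁻ x, f x ∂configMeasure I (n + 1) =
      ∫⁻ x in I, ∫⁻ y, f (Fin.cons x y) ∂configMeasure I n := by
  rw [← (measurePreserving_cons I n).lintegral_comp hf, lintegral_prod]
  exact (hf.comp (measurableEmbedding_cons n).measurable).aemeasurable

theorem ae_config_succ {I : Set ℝ} {n : ℕ} {p : (Fin (n + 1) → ℝ) → Prop}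
    (h : ∀ᵐ x ∂configMeasure I (n + 1), p x) :
    ∀ᵐ x ∂volume.restrict I, ∀ᵐ y ∂configMeasure I n, p (Fin.cons x y) :=
  Measure.ae_ae_of_ae_prod ((measurePreserving_cons I n).quasiMeasurePreserving.ae h)

theorem ae_config_succ' {I : Set ℝ} {n : ℕ} {p : (Fin (n + 1) → ℝ) → Prop}
    (h : ∀ᵐ x ∂configMeasure I (n + 1), p x) :
    ∀ᵐ y ∂configMeasure I n, ∀ᵐ x ∂volume.restrict I, p (Fin.cons x y) :=
  Measure.ae_ae_of_ae_prod (((measurePreserving_cons I n).comp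
    Measure.measurePreserving_swap).quasiMeasurePreserving.ae h)

/-- Passing from null slices back to a null set requires measurability of the set; this is why
measurability of the Dyson integrand is proved separately. -/
theorem ae_config_succ_of {I : Set ℝ} {n : ℕ} {p : (Fin (n + 1) → ℝ) → Prop}
    (hp : MeasurableSet {x | p x})
    (h : ∀ᵐ x ∂volume.restrict I, ∀ᵐ y ∂configMeasure I n, p (Fin.cons x y)) :
    ∀ᵐ x ∂configMeasure I (n + 1), p x := by
  rw [← (measurePreserving_cons I n).map_eq,
    ae_map_iff (measurePreserving_cons I n).aemeasurable hp]
  refine (Measure.ae_prod_iff_ae_ae ?_).2 h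
  exact (measurableEmbedding_cons n).measurable hp

/-! ### Square integrals -/

/-- Cauchy–Schwarz, squared to avoid half powers. -/
theorem sq_lintegral_mul_le {X : Type*} [MeasurableSpace X] (μ : Measure X) {f g : X → ENNReal}
    (hf : AEMeasurable f μ) (hg : AEMeasurable g μ) :
    (∫⁻ x, f x * g x ∂μ) ^ 2 ≤ (∫⁻ x, f x ^ 2 ∂μ) * ∫⁻ x, g x ^ 2 ∂μ := by
  have h := ENNReal.lintegral_mul_le_Lp_mul_Lq μ Real.HolderConjugate.two_two hf hg
  have h2 := pow_le_pow_left' h 2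
  rw [mul_pow, ← ENNReal.rpow_natCast (_ ^ _), ← ENNReal.rpow_natCast (_ ^ _ : ENNReal) 2,
    ← ENNReal.rpow_mul, ← ENNReal.rpow_mul] at h2
  norm_num at h2
  simpa using h2

theorem eLpNorm_two_sq {X : Type*} [MeasurableSpace X] (μ : Measure X) (f : X → ℂ) :
    eLpNorm f 2 μ ^ 2 = ∫⁻ x, ‖f x‖ₑ ^ 2 ∂μ := by
  rw [eLpNorm_eq_lintegral_rpow_enorm_toReal (by norm_num) (by norm_num),
    ← ENNReal.rpow_natCast, ← ENNReal.rpow_mul]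
  norm_num

theorem memLp_two_iff_lintegral {X : Type*} [MeasurableSpace X] {μ : Measure X} {f : X → ℂ}
    (hf : AEStronglyMeasurable f μ) :
    MemLp f 2 μ ↔ ∫⁻ x, ‖f x‖ₑ ^ 2 ∂μ ≠ ⊤ := by
  rw [MemLp, and_iff_right hf, ← eLpNorm_two_sq, lt_top_iff_ne_top]
  simp

theorem memLp_two_mul_prod {X Y : Type*} [MeasurableSpace X] [MeasurableSpace Y] {μ : Measure X}
    {ν : Measure Y} [SFinite μ] [SFinite ν] {f : X → ℂ} {g : Y → ℂ} (hf : MemLp f 2 μ)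
    (hg : MemLp g 2 ν) : MemLp (fun p : X × Y => f p.1 * g p.2) 2 (μ.prod ν) := by
  have hm : AEStronglyMeasurable (fun p : X × Y => f p.1 * g p.2) (μ.prod ν) :=
    hf.1.comp_fst.mul hg.1.comp_snd
  rw [memLp_two_iff_integrable_sq_norm hm]
  have := ((memLp_two_iff_integrable_sq_norm hf.1).1 hf).mul_prod
    ((memLp_two_iff_integrable_sq_norm hg.1).1 hg)
  simpa [mul_pow] using this

/-! ### Symmetric wave functions -/

/-- A measurable, square integrable function that is invariant under all permutations of the
particles, everywhere and not just almost everywhere. -/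
structure IsWave (I : Set ℝ) (n : ℕ) (f : (Fin n → ℝ) → ℂ) : Prop where
  measurable : Measurable f
  memLp : MemLp f 2 (configMeasure I n)
  symm : ∀ (σ : Equiv.Perm (Fin n)) (x : Fin n → ℝ), f (x ∘ σ) = f x

theorem coeFn_exchange {I : Set ℝ} {n : ℕ} (σ : Equiv.Perm (Fin n))
    (f : Lp ℂ 2 (configMeasure I n)) :
    exchange I n σ f =ᵐ[configMeasure I n] fun x => f (x ∘ σ) :=
  Lp.coeFn_compMeasurePreserving f (measurePreserving_perm I n σ)

/-- The element of the `n`-particle sector given by a symmetric wave function. -/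
def IsWave.toSector {I : Set ℝ} {n : ℕ} {f : (Fin n → ℝ) → ℂ} (hf : IsWave I n f) :
    sector I n :=
  ⟨hf.memLp.toLp f, fun σ => by
    apply Lp.ext
    refine (coeFn_exchange σ _).trans ?_
    have h := hf.memLp.coeFn_toLp
    have h2 := (measurePreserving_perm I n σ).quasiMeasurePreserving.ae h
    filter_upwards [h, h2] with x hx hx2
    rw [hx2, hx, hf.symm]⟩

theorem IsWave.coeFn_toSector {I : Set ℝ} {n : ℕ} {f : (Fin n → ℝ) → ℂ} (hf : IsWave I n f) :
    ((hf.toSector : Lp ℂ 2 (configMeasure I n)) : (Fin n → ℝ) → ℂ)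
      =ᵐ[configMeasure I n] f :=
  hf.memLp.coeFn_toLp

/-- The symmetrization of a function of `n` variables. -/
def symmetrize {n : ℕ} (f : (Fin n → ℝ) → ℂ) (x : Fin n → ℝ) : ℂ :=
  (n.factorial : ℂ)⁻¹ * ∑ σ : Equiv.Perm (Fin n), f (x ∘ σ)

theorem symmetrize_comp_perm {n : ℕ} (f : (Fin n → ℝ) → ℂ) (σ : Equiv.Perm (Fin n))
    (x : Fin n → ℝ) : symmetrize f (x ∘ σ) = symmetrize f x := by
  unfold symmetrize
  congr 1
  exact Fintype.sum_equiv (Equiv.mulLeft σ) _ _ fun τ => by simp [Function.comp_assoc]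

/-- A symmetric representative of an element of the `n`-particle sector. -/
def wave {I : Set ℝ} {n : ℕ} (f : sector I n) : (Fin n → ℝ) → ℂ :=
  symmetrize (f : Lp ℂ 2 (configMeasure I n))

/-- The permutation group is finite, so all the almost-everywhere symmetries hold at once off a null
set, where averaging changes nothing. Symmetry at every point matters later, since fixing one
argument restricts to a null set. -/
theorem wave_ae_eq {I : Set ℝ} {n : ℕ} (f : sector I n) :
    wave f =ᵐ[configMeasure I n] (f : Lp ℂ 2 (configMeasure I n)) := by
  have h : ∀ᵐ x ∂configMeasure I n, ∀ σ : Equiv.Perm (Fin n),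
      (f : Lp ℂ 2 (configMeasure I n)) (x ∘ σ) = (f : Lp ℂ 2 (configMeasure I n)) x := by
    rw [ae_all_iff]
    intro σ
    have h1 := coeFn_exchange σ (f : Lp ℂ 2 (configMeasure I n))
    rw [f.2 σ] at h1
    exact h1.symm
  filter_upwards [h] with x hx
  simp [wave, symmetrize, hx, Fintype.card_perm, Nat.factorial_ne_zero]

theorem isWave_wave {I : Set ℝ} {n : ℕ} (f : sector I n) : IsWave I n (wave f) where
  measurable := by
    have hf : Measurable (f : Lp ℂ 2 (configMeasure I n)) :=
      (Lp.stronglyMeasurable (f : Lp ℂ 2 (configMeasure I n))).measurable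
    refine measurable_const.mul (Finset.measurable_sum _ fun σ _ => hf.comp ?_)
    exact (measurePreserving_perm I n σ).measurable
  memLp := (memLp_congr_ae (wave_ae_eq f)).2 (Lp.memLp _)
  symm σ x := symmetrize_comp_perm _ σ x

theorem sector_ext {I : Set ℝ} {n : ℕ} {f g : sector I n}
    (h : wave f =ᵐ[configMeasure I n] wave g) : f = g :=
  Subtype.ext (Lp.ext ((wave_ae_eq f).symm.trans (h.trans (wave_ae_eq g))))

theorem IsWave.wave_toSector {I : Set ℝ} {n : ℕ} {f : (Fin n → ℝ) → ℂ} (hf : IsWave I n f) :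
    wave hf.toSector =ᵐ[configMeasure I n] f :=
  (wave_ae_eq _).trans hf.coeFn_toSector

theorem sector_inner {I : Set ℝ} {n : ℕ} (f g : sector I n) :
    inner ℂ f g = ∫ x, conj (wave f x) * wave g x ∂configMeasure I n := by
  change inner ℂ (f : Lp ℂ 2 (configMeasure I n)) (g : Lp ℂ 2 (configMeasure I n)) = _
  rw [L2.inner_def]
  refine integral_congr_ae ?_
  filter_upwards [wave_ae_eq f, wave_ae_eq g] with x hf hg
  rw [hf, hg, RCLike.inner_apply, mul_comm]

theorem sector_enorm_sq {I : Set ℝ} {n : ℕ} (f : sector I n) :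
    ‖f‖ₑ ^ 2 = ∫⁻ x, ‖wave f x‖ₑ ^ 2 ∂configMeasure I n := by
  change ‖(f : Lp ℂ 2 (configMeasure I n))‖ₑ ^ 2 = _
  rw [Lp.enorm_def, eLpNorm_two_sq]
  refine lintegral_congr_ae ?_
  filter_upwards [wave_ae_eq f] with x hf
  rw [hf]

/-! ### Annihilation and creation of a particle in the state `α` -/

/-- Annihilation of a particle with wave function `α`, on functions of `n + 1` variables. -/
def annih (I : Set ℝ) (α : ℝ → ℂ) {n : ℕ} (f : (Fin (n + 1) → ℝ) → ℂ) (y : Fin n → ℝ) : ℂ :=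
  (Real.sqrt (n + 1) : ℂ) * ∫ x in I, conj (α x) * f (Fin.cons x y)

/-- Creation of a particle with wave function `α`, on functions of `n` variables. -/
def create (α : ℝ → ℂ) {n : ℕ} (f : (Fin n → ℝ) → ℂ) (x : Fin (n + 1) → ℝ) : ℂ :=
  (Real.sqrt (n + 1) : ℂ)⁻¹ * ∑ i, α (x i) * f (i.removeNth x)

theorem sqrt_succ_ne_zero (n : ℕ) : (Real.sqrt (n + 1) : ℂ) ≠ 0 := by
  exact_mod_cast (Real.sqrt_pos.2 (by positivity : (0 : ℝ) < n + 1)).ne'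

theorem sqrt_succ_mul_self (n : ℕ) : (Real.sqrt (n + 1) : ℂ) * Real.sqrt (n + 1) = n + 1 := by
  exact_mod_cast Real.mul_self_sqrt (by positivity : (0 : ℝ) ≤ n + 1)

theorem enorm_sqrt_succ_sq (n : ℕ) : ‖(Real.sqrt (n + 1) : ℂ)‖ₑ ^ 2 = n + 1 := by
  rw [← enorm_pow, pow_two, sqrt_succ_mul_self, ← Nat.cast_succ, ← Nat.cast_succ,
    ← ofReal_norm, Complex.norm_natCast, ENNReal.ofReal_natCast]

/-- A permutation of the last arguments extends to all of them by fixing the first; hence slices of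
symmetric functions are symmetric. -/
theorem cons_comp_perm {n : ℕ} (σ : Equiv.Perm (Fin n)) (x : ℝ) (y : Fin n → ℝ) :
    (Fin.cons x (y ∘ σ) : Fin (n + 1) → ℝ) =
      Fin.cons x y ∘ Equiv.Perm.decomposeFin.symm (0, σ) := by
  funext i
  refine Fin.cases ?_ (fun j => ?_) i <;> simp

theorem slice_symm {n : ℕ} {f : (Fin (n + 1) → ℝ) → ℂ}
    (hf : ∀ (σ : Equiv.Perm (Fin (n + 1))) (x : Fin (n + 1) → ℝ), f (x ∘ σ) = f x) (x : ℝ)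
    (σ : Equiv.Perm (Fin n)) (y : Fin n → ℝ) :
    f (Fin.cons x (y ∘ σ)) = f (Fin.cons x y) := by
  rw [cons_comp_perm, hf]

section

variable {I : Set ℝ} {α : ℝ → ℂ} {n : ℕ}

theorem lintegral_enorm_sq_ne_top (hα2 : MemLp α 2 (volume.restrict I)) :
    ∫⁻ x in I, ‖α x‖ₑ ^ 2 ≠ ⊤ :=
  (memLp_two_iff_lintegral hα2.1).1 hα2

theorem IsWave.lintegral_ne_top {f : (Fin n → ℝ) → ℂ} (hf : IsWave I n f) :
    ∫⁻ x, ‖f x‖ₑ ^ 2 ∂configMeasure I n ≠ ⊤ :=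
  (memLp_two_iff_lintegral hf.memLp.1).1 hf.memLp

theorem IsWave.const_mul {f : (Fin n → ℝ) → ℂ} (hf : IsWave I n f) (c : ℂ) :
    IsWave I n fun x => c * f x :=
  ⟨measurable_const.mul hf.measurable, hf.memLp.const_mul c, fun σ x => by rw [hf.symm]⟩

/-- Only square integrability can fail on a slice, and by Tonelli it does so on a null set of `x`.
-/
theorem IsWave.slice {f : (Fin (n + 1) → ℝ) → ℂ} (hf : IsWave I (n + 1) f) :
    ∀ᵐ x ∂volume.restrict I, IsWave I n fun y => f (Fin.cons x y) := by
  have h := hf.lintegral_ne_top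
  rw [lintegral_config_succ (hf.measurable.enorm.pow_const 2)] at h
  have hm := hf.measurable
  have hx : ∀ x, Measurable fun y : Fin n → ℝ => f (Fin.cons x y) := fun x => by fun_prop
  have hm2 : Measurable fun x : ℝ => ∫⁻ y, ‖f (Fin.cons x y)‖ₑ ^ 2 ∂configMeasure I n := by
    apply Measurable.lintegral_prod_right'
      (f := fun p : ℝ × (Fin n → ℝ) => ‖f (Fin.cons p.1 p.2)‖ₑ ^ 2)
    fun_prop
  filter_upwards [ae_lt_top hm2 h] with x hx2
  exact ⟨hx x, (memLp_two_iff_lintegral (hx x).aestronglyMeasurable).2 hx2.ne,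
    fun σ y => slice_symm hf.symm x σ y⟩

theorem measurable_annih (hα : Measurable α) {f : (Fin (n + 1) → ℝ) → ℂ} (hf : Measurable f) :
    Measurable (annih I α f) := by
  refine measurable_const.mul (StronglyMeasurable.measurable ?_)
  apply StronglyMeasurable.integral_prod_right
    (f := fun (y : Fin n → ℝ) (x : ℝ) => conj (α x) * f (Fin.cons x y))
  apply Measurable.stronglyMeasurable
  have : Measurable (conj : ℂ → ℂ) := Complex.continuous_conj.measurable
  simp only [Function.uncurry_def]
  fun_prop

theorem enorm_annih_sq_le (hα : Measurable α) {f : (Fin (n + 1) → ℝ) → ℂ} (hf : Measurable f)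
    (y : Fin n → ℝ) :
    ‖annih I α f y‖ₑ ^ 2 ≤
      (n + 1) * ((∫⁻ x in I, ‖α x‖ₑ ^ 2) * ∫⁻ x in I, ‖f (Fin.cons x y)‖ₑ ^ 2) := by
  rw [annih, enorm_mul, mul_pow, enorm_sqrt_succ_sq]
  gcongr
  refine le_trans ?_ (sq_lintegral_mul_le _ (f := fun x => ‖α x‖ₑ)
    (g := fun x => ‖f (Fin.cons x y)‖ₑ) ?_ ?_)
  · gcongr
    refine (enorm_integral_le_lintegral_enorm _).trans (le_of_eq ?_)
    simp [enorm_mul]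
  · fun_prop
  · have : Measurable fun x : ℝ => f (Fin.cons x y) := by fun_prop
    fun_prop

/-- The number bound `‖a f‖² ≤ (n + 1) ‖α‖² ‖f‖²`: the pointwise Cauchy–Schwarz estimate integrated
by Tonelli. -/
theorem lintegral_annih_sq_le (hα : Measurable α) {f : (Fin (n + 1) → ℝ) → ℂ}
    (hf : Measurable f) :
    ∫⁻ y, ‖annih I α f y‖ₑ ^ 2 ∂configMeasure I n ≤
      (n + 1) * ((∫⁻ x in I, ‖α x‖ₑ ^ 2) * ∫⁻ x, ‖f x‖ₑ ^ 2 ∂configMeasure I (n + 1)) := by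
  have hm : Measurable fun p : ℝ × (Fin n → ℝ) => ‖f (Fin.cons p.1 p.2)‖ₑ ^ 2 := by fun_prop
  refine (lintegral_mono fun y => enorm_annih_sq_le hα hf y).trans (le_of_eq ?_)
  rw [lintegral_const_mul, lintegral_const_mul, lintegral_config_succ (by fun_prop),
    lintegral_lintegral_swap]
  · exact (hm.comp measurable_swap).aemeasurable
  · exact hm.lintegral_prod_left'
  · exact hm.lintegral_prod_left'.const_mul _

theorem IsWave.annih (hα : Measurable α) (hα2 : MemLp α 2 (volume.restrict I))
    {f : (Fin (n + 1) → ℝ) → ℂ} (hf : IsWave I (n + 1) f) : IsWave I n (annih I α f) where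
  measurable := measurable_annih hα hf.measurable
  memLp := by
    rw [memLp_two_iff_lintegral (measurable_annih hα hf.measurable).aestronglyMeasurable]
    refine ((lintegral_annih_sq_le hα hf.measurable).trans_lt ?_).ne
    have h1 := lintegral_enorm_sq_ne_top hα2
    have h2 := hf.lintegral_ne_top
    have h3 : (n + 1 : ENNReal) ≠ ⊤ := by simp
    exact (ENNReal.mul_ne_top h3 (ENNReal.mul_ne_top h1 h2)).lt_top
  symm σ y := by simp only [ContinuousMPO.annih, slice_symm hf.symm]

theorem annih_congr_ae {f g : (Fin (n + 1) → ℝ) → ℂ} (h : f =ᵐ[configMeasure I (n + 1)] g) :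
    annih I α f =ᵐ[configMeasure I n] annih I α g := by
  filter_upwards [ae_config_succ' h] with y hy
  unfold annih
  congr 1
  apply integral_congr_ae
  filter_upwards [hy] with x hx
  rw [hx]

/-- `σ` maps the complement of `i` onto that of `σ i`; identifying both with `Fin n` gives `τ`.
Permuting the arguments of `create α f` thus only permutes its summands. -/
theorem exists_removeNth_comp (i : Fin (n + 1)) (σ : Equiv.Perm (Fin (n + 1))) :
    ∃ τ : Equiv.Perm (Fin n), ∀ x : Fin (n + 1) → ℝ,
      i.removeNth (x ∘ σ) = (σ i).removeNth x ∘ τ := by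
  let e : {j // j ≠ i} ≃ {j // j ≠ σ i} := σ.subtypeEquiv fun j => by simp
  refine ⟨((finSuccAboveEquiv i).trans e).trans (finSuccAboveEquiv (σ i)).symm, fun x => ?_⟩
  funext j
  have h : (σ i).succAbove ((finSuccAboveEquiv (σ i)).symm (e (finSuccAboveEquiv i j))) =
      σ (i.succAbove j) := by
    have := (finSuccAboveEquiv (σ i)).apply_symm_apply (e (finSuccAboveEquiv i j))
    exact congrArg Subtype.val this
  simp [Fin.removeNth, h]

theorem IsWave.create (hα : Measurable α) (hα2 : MemLp α 2 (volume.restrict I))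
    {f : (Fin n → ℝ) → ℂ} (hf : IsWave I n f) : IsWave I (n + 1) (create α f) where
  measurable := by
    refine measurable_const.mul (Finset.measurable_sum _ fun i _ => ?_)
    have h2 : Measurable fun x : Fin (n + 1) → ℝ => i.removeNth x :=
      measurable_pi_lambda _ fun j => measurable_pi_apply _
    exact (hα.comp (measurable_pi_apply i)).mul (hf.measurable.comp h2)
  memLp := by
    have h : ∀ i : Fin (n + 1), MemLp (fun x : Fin (n + 1) → ℝ => α (x i) * f (i.removeNth x)) 2
        (configMeasure I (n + 1)) := fun i =>
      (memLp_two_mul_prod hα2 hf.memLp).comp_measurePreserving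
        (measurePreserving_piFinSuccAbove (fun _ => volume.restrict I) i)
    have h2 : MemLp (fun x : Fin (n + 1) → ℝ => ∑ i, α (x i) * f (i.removeNth x)) 2
        (configMeasure I (n + 1)) := memLp_finsetSum _ fun i _ => h i
    exact h2.const_mul _
  symm σ x := by
    unfold ContinuousMPO.create
    congr 1
    refine Fintype.sum_equiv σ _ _ fun i => ?_
    obtain ⟨τ, hτ⟩ := exists_removeNth_comp i σ
    rw [hτ, hf.symm, Function.comp_apply]

/-- The origin of the commutation relation: after annihilation, the summand with the created
particle at `x` gives the scalar term, and the others give creation after annihilation. -/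
theorem create_cons (f : (Fin (n + 1) → ℝ) → ℂ) (x : ℝ) (y : Fin (n + 1) → ℝ) :
    create α f (Fin.cons x y) = (Real.sqrt ((n + 1 : ℕ) + 1) : ℂ)⁻¹ *
      (α x * f y + ∑ i, α (y i) * f (Fin.cons x (i.removeNth y))) := by
  rw [create, Fin.sum_univ_succ]
  congr 2
  · refine Finset.sum_congr rfl fun i _ => ?_
    rw [Fin.cons_succ]
    congr 2
    funext j
    refine Fin.cases ?_ (fun k => ?_) j <;> simp [Fin.removeNth]

/-! ### Adjointness and the canonical commutation relation -/

/-- The integrand is a product of the square integrable functions `α ⊗ h` and `conj f`; this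
justifies every use of Fubini for annihilation and creation. -/
theorem integrable_annih_prod (hα2 : MemLp α 2 (volume.restrict I))
    {f : (Fin (n + 1) → ℝ) → ℂ} (hf : MemLp f 2 (configMeasure I (n + 1)))
    {h : (Fin n → ℝ) → ℂ} (hh : MemLp h 2 (configMeasure I n)) :
    Integrable (fun p : ℝ × (Fin n → ℝ) => α p.1 * (conj (f (Fin.cons p.1 p.2)) * h p.2))
      ((volume.restrict I).prod (configMeasure I n)) := by
  have h1 := memLp_two_mul_prod hα2 hh
  have h2 : MemLp (fun p : ℝ × (Fin n → ℝ) => conj (f (Fin.cons p.1 p.2))) 2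
      ((volume.restrict I).prod (configMeasure I n)) :=
    (hf.comp_measurePreserving (measurePreserving_cons I n)).star
  have := h1.integrable_mul h2
  refine this.congr (Filter.Eventually.of_forall fun p => ?_)
  simp only [Pi.mul_apply]
  ring

theorem integrable_annih_slice (hα2 : MemLp α 2 (volume.restrict I))
    {f : (Fin (n + 1) → ℝ) → ℂ} (hf : MemLp f 2 (configMeasure I (n + 1)))
    {h : (Fin n → ℝ) → ℂ} (hh : MemLp h 2 (configMeasure I n)) :
    Integrable (fun x => α x *
      ∫ y, conj ((Real.sqrt (n + 1) : ℂ) * f (Fin.cons x y)) * h y ∂configMeasure I n)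
      (volume.restrict I) := by
  have := ((integrable_annih_prod hα2 hf hh).integral_prod_left).const_mul (Real.sqrt (n + 1) : ℂ)
  refine this.congr (Filter.Eventually.of_forall fun x => ?_)
  simp only [map_mul, Complex.conj_ofReal, mul_assoc, integral_const_mul]
  ring

theorem integral_conj_annih_mul (hα2 : MemLp α 2 (volume.restrict I))
    {f : (Fin (n + 1) → ℝ) → ℂ} (hf : MemLp f 2 (configMeasure I (n + 1)))
    {h : (Fin n → ℝ) → ℂ} (hh : MemLp h 2 (configMeasure I n)) :
    ∫ x in I, α x *
      ∫ y, conj ((Real.sqrt (n + 1) : ℂ) * f (Fin.cons x y)) * h y ∂configMeasure I n =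
    ∫ y, conj (annih I α f y) * h y ∂configMeasure I n := by
  have h1 := integral_integral_swap
    (f := fun x y => α x * (conj (f (Fin.cons x y)) * h y)) (integrable_annih_prod hα2 hf hh)
  simp only [annih, map_mul, Complex.conj_ofReal, mul_assoc, integral_const_mul] at h1 ⊢
  simp only [mul_left_comm _ (Real.sqrt (n + 1) : ℂ), integral_const_mul]
  rw [h1]
  congr 1
  refine integral_congr_ae (Filter.Eventually.of_forall fun y => ?_)
  simp only [← integral_conj, map_mul, Complex.conj_conj, ← mul_assoc, integral_mul_const]

/-- By symmetry of `f` the `n + 1` summands of `create` have equal integrals, and `(n + 1)/√(n + 1)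
= √(n + 1)` is the normalization of `annih`. -/
theorem integral_conj_mul_create (hα2 : MemLp α 2 (volume.restrict I))
    {f : (Fin (n + 1) → ℝ) → ℂ} (hf : IsWave I (n + 1) f)
    {h : (Fin n → ℝ) → ℂ} (hh : MemLp h 2 (configMeasure I n)) :
    ∫ x, conj (f x) * create α h x ∂configMeasure I (n + 1) =
    ∫ y, conj (annih I α f y) * h y ∂configMeasure I n := by
  -- Insertion at position `i` and at position `0` differ by a cycle, which `f` does not see.
  have key : ∀ i : Fin (n + 1), ∀ p : ℝ × (Fin n → ℝ),
      f (i.insertNth p.1 p.2) = f (Fin.cons p.1 p.2) := fun i p => by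
    rw [← Fin.cons_comp_cycleRange, hf.symm]
  have hint : ∀ i : Fin (n + 1), Integrable
      (fun x => conj (f x) * (α (x i) * h (i.removeNth x))) (configMeasure I (n + 1)) := fun i => by
    rw [← (measurePreserving_insertNth I i).integrable_comp_emb (measurableEmbedding_insertNth i)]
    refine (integrable_annih_prod hα2 hf.memLp hh).congr (Filter.Eventually.of_forall fun p => ?_)
    simp [key]
    ring
  have hval : ∀ i : Fin (n + 1),
      ∫ x, conj (f x) * (α (x i) * h (i.removeNth x)) ∂configMeasure I (n + 1) =
        ∫ x in I, α x * ∫ y, conj (f (Fin.cons x y)) * h y ∂configMeasure I n := fun i => by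
    rw [← (measurePreserving_insertNth I i).integral_comp (measurableEmbedding_insertNth i)]
    simp only [key, Fin.insertNth_apply_same, Fin.removeNth_insertNth, ← integral_const_mul]
    rw [← integral_prod _ (integrable_annih_prod hα2 hf.memLp hh)]
    refine integral_congr_ae (Filter.Eventually.of_forall fun p => ?_)
    simp only
    ring
  rw [← integral_conj_annih_mul hα2 hf.memLp hh]
  unfold create
  simp only [mul_left_comm _ (Real.sqrt (n + 1) : ℂ)⁻¹, integral_const_mul]
  simp only [Finset.mul_sum]
  rw [integral_finsetSum _ fun i _ => hint i]
  simp only [hval, map_mul, Complex.conj_ofReal, mul_assoc, integral_const_mul,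
    mul_left_comm _ (Real.sqrt (n + 1) : ℂ), Finset.sum_const, Finset.card_univ, Fintype.card_fin,
    nsmul_eq_mul]
  rw [Nat.cast_succ, ← sqrt_succ_mul_self, mul_assoc, inv_mul_cancel_left₀ (sqrt_succ_ne_zero n)]

theorem integrable_conj_mul_self (hα2 : MemLp α 2 (volume.restrict I)) :
    Integrable (fun x => conj (α x) * α x) (volume.restrict I) :=
  hα2.star.integrable_mul hα2

theorem quasiMeasurePreserving_removeNth (I : Set ℝ) {n : ℕ} (i : Fin (n + 1)) :
    Measure.QuasiMeasurePreserving (fun x : Fin (n + 1) → ℝ => i.removeNth x)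
      (configMeasure I (n + 1)) (configMeasure I n) := by
  exact Measure.quasiMeasurePreserving_snd.comp
    (measurePreserving_piFinSuccAbove (fun _ => volume.restrict I) i).quasiMeasurePreserving

theorem annih_create_zero (f : (Fin 0 → ℝ) → ℂ) (y : Fin 0 → ℝ) :
    annih I α (create α f) y = (∫ x in I, conj (α x) * α x) * f y := by
  have h : ∀ x, create α f (Fin.cons x y) = α x * f y := fun x => by
    have hy : Fin.removeNth (0 : Fin 1) (Fin.cons x y : Fin 1 → ℝ) = y := Subsingleton.elim _ _
    simp [create, hy]
  simp [annih, h, ← mul_assoc, integral_mul_const]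

theorem annih_create_succ (hα2 : MemLp α 2 (volume.restrict I)) {f : (Fin (n + 1) → ℝ) → ℂ}
    (hf : MemLp f 2 (configMeasure I (n + 1))) :
    annih I α (create α f) =ᵐ[configMeasure I (n + 1)]
      fun y => create α (annih I α f) y + (∫ x in I, conj (α x) * α x) * f y := by
  -- Splitting the integral of the sum requires integrable slices, which is why the relation is
  -- obtained only almost everywhere.
  have hs : ∀ᵐ y ∂configMeasure I n,
      Integrable (fun x => conj (α x) * f (Fin.cons x y)) (volume.restrict I) := by
    have h1 : MemLp (fun p : ℝ × (Fin n → ℝ) => f (Fin.cons p.1 p.2)) 2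
        ((volume.restrict I).prod (configMeasure I n)) :=
      hf.comp_measurePreserving (measurePreserving_cons I n)
    have h2 := ((memLp_two_iff_integrable_sq_norm h1.1).1 h1).prod_left_ae
    filter_upwards [h2, h1.1.prodMk_right] with y hy hy2
    exact hα2.star.integrable_mul ((memLp_two_iff_integrable_sq_norm hy2).2 hy)
  have hs2 : ∀ᵐ y ∂configMeasure I (n + 1), ∀ i : Fin (n + 1),
      Integrable (fun x => conj (α x) * f (Fin.cons x (i.removeNth y))) (volume.restrict I) :=
    ae_all_iff.2 fun i => (quasiMeasurePreserving_removeNth I i).ae hs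
  filter_upwards [hs2] with y hy
  have hne := sqrt_succ_ne_zero (n + 1)
  simp only [annih, create_cons]
  rw [create]
  simp only [mul_left_comm _ (Real.sqrt ((n + 1 : ℕ) + 1) : ℂ)⁻¹, integral_const_mul]
  rw [inv_mul_cancel_left₀ hne]
  simp only [mul_add, Finset.mul_sum]
  rw [integral_add, integral_finsetSum]
  · rw [add_comm]
    congr 1
    · refine Finset.sum_congr rfl fun i _ => ?_
      rw [annih, mul_left_comm _ (Real.sqrt (n + 1) : ℂ), inv_mul_cancel_left₀
        (sqrt_succ_ne_zero n), ← integral_const_mul]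
      congr 1
      funext x
      ring
    · simp only [← mul_assoc, integral_mul_const]
  · intro i _
    refine ((hy i).const_mul (α (y i))).congr (Filter.Eventually.of_forall fun x => ?_)
    simp only
    ring
  · simp only [← mul_assoc]
    exact (integrable_conj_mul_self hα2).mul_const _
  · refine integrable_finsetSum _ fun i _ => ?_
    refine ((hy i).const_mul (α (y i))).congr (Filter.Eventually.of_forall fun x => ?_)
    simp only
    ring

end

/-! ### Annihilation and creation operators between the sectors -/

section

variable {I : Set ℝ} {α : ℝ → ℂ} {n : ℕ}

theorem wave_add (f g : sector I n) :
    wave (f + g) =ᵐ[configMeasure I n] fun x => wave f x + wave g x := by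
  have h := Lp.coeFn_add (f : Lp ℂ 2 (configMeasure I n)) (g : Lp ℂ 2 (configMeasure I n))
  filter_upwards [wave_ae_eq f, wave_ae_eq g, wave_ae_eq (f + g), h] with x h1 h2 h3 h4
  rw [h1, h2, h3, Submodule.coe_add, h4, Pi.add_apply]

theorem wave_smul (c : ℂ) (f : sector I n) :
    wave (c • f) =ᵐ[configMeasure I n] fun x => c * wave f x := by
  have h := Lp.coeFn_smul c (f : Lp ℂ 2 (configMeasure I n))
  filter_upwards [wave_ae_eq f, wave_ae_eq (c • f), h] with x h1 h3 h4
  rw [h1, h3, Submodule.coe_smul, h4, Pi.smul_apply, smul_eq_mul]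

theorem wave_zero : wave (0 : sector I n) =ᵐ[configMeasure I n] fun _ => 0 := by
  have h := wave_smul 0 (0 : sector I n)
  simpa using h

theorem create_congr_ae {f g : (Fin n → ℝ) → ℂ} (h : f =ᵐ[configMeasure I n] g) :
    create α f =ᵐ[configMeasure I (n + 1)] create α g := by
  have h2 : ∀ᵐ x ∂configMeasure I (n + 1), ∀ i : Fin (n + 1),
      f (i.removeNth x) = g (i.removeNth x) :=
    ae_all_iff.2 fun i => (quasiMeasurePreserving_removeNth I i).ae h
  filter_upwards [h2] with x hx
  simp only [create, hx]

/-- Besides adjointness this supplies linearity: the operators are built from chosen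
representatives, and testing against all vectors removes the choice. -/
theorem inner_toSector_annih (hα : Measurable α) (hα2 : MemLp α 2 (volume.restrict I))
    (f : sector I (n + 1)) (g : sector I n) :
    inner ℂ ((isWave_wave f).annih hα hα2).toSector g =
      inner ℂ f ((isWave_wave g).create hα hα2).toSector := by
  rw [sector_inner, sector_inner]
  calc ∫ x, conj (wave ((isWave_wave f).annih hα hα2).toSector x) * wave g x ∂configMeasure I n
      = ∫ x, conj (annih I α (wave f) x) * wave g x ∂configMeasure I n := by
        refine integral_congr_ae ?_
        filter_upwards [((isWave_wave f).annih hα hα2).wave_toSector] with x hx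
        rw [hx]
    _ = ∫ x, conj (wave f x) * create α (wave g) x ∂configMeasure I (n + 1) :=
        (integral_conj_mul_create hα2 (isWave_wave f) (isWave_wave g).memLp).symm
    _ = _ := by
        refine integral_congr_ae ?_
        filter_upwards [((isWave_wave g).create hα hα2).wave_toSector] with x hx
        rw [hx]

/-- The annihilation operator of `α` from the `n + 1`-particle to the `n`-particle sector. -/
def sectorAnnih (hα : Measurable α) (hα2 : MemLp α 2 (volume.restrict I)) (n : ℕ) :
    sector I (n + 1) →ₗ[ℂ] sector I n where
  toFun f := ((isWave_wave f).annih hα hα2).toSector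
  map_add' f g := by
    refine ext_inner_right ℂ fun h => ?_
    rw [inner_add_left]
    exact (inner_toSector_annih hα hα2 (f + g) h).trans ((inner_add_left _ _ _).trans
      (congrArg₂ _ (inner_toSector_annih hα hα2 f h) (inner_toSector_annih hα hα2 g h)).symm)
  map_smul' c f := by
    refine ext_inner_right ℂ fun h => ?_
    rw [inner_smul_left]
    exact (inner_toSector_annih hα hα2 (c • f) h).trans ((inner_smul_left f _ c).trans
      (congrArg _ (inner_toSector_annih hα hα2 f h)).symm)

/-- The creation operator of `α` from the `n`-particle to the `n + 1`-particle sector. -/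
def sectorCreate (hα : Measurable α) (hα2 : MemLp α 2 (volume.restrict I)) (n : ℕ) :
    sector I n →ₗ[ℂ] sector I (n + 1) where
  toFun f := ((isWave_wave f).create hα hα2).toSector
  map_add' f g := by
    refine ext_inner_left ℂ fun h => ?_
    rw [inner_add_right]
    exact (inner_toSector_annih hα hα2 h (f + g)).symm.trans ((inner_add_right _ _ _).trans
      (congrArg₂ _ (inner_toSector_annih hα hα2 h f) (inner_toSector_annih hα hα2 h g)))
  map_smul' c f := by
    refine ext_inner_left ℂ fun h => ?_
    rw [inner_smul_right]
    exact (inner_toSector_annih hα hα2 h (c • f)).symm.trans ((inner_smul_right _ f c).trans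
      (congrArg _ (inner_toSector_annih hα hα2 h f)))

variable (hα : Measurable α) (hα2 : MemLp α 2 (volume.restrict I))

theorem inner_sectorAnnih (f : sector I (n + 1)) (g : sector I n) :
    inner ℂ (sectorAnnih hα hα2 n f) g = inner ℂ f (sectorCreate hα hα2 n g) :=
  inner_toSector_annih hα hα2 f g

theorem wave_sectorAnnih (f : sector I (n + 1)) :
    wave (sectorAnnih hα hα2 n f) =ᵐ[configMeasure I n] annih I α (wave f) :=
  ((isWave_wave f).annih hα hα2).wave_toSector

theorem wave_sectorCreate (f : sector I n) :
    wave (sectorCreate hα hα2 n f) =ᵐ[configMeasure I (n + 1)] create α (wave f) :=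
  ((isWave_wave f).create hα hα2).wave_toSector

/-- The squared norm of `α`. -/
def normSq (I : Set ℝ) (α : ℝ → ℂ) : ℝ := (∫⁻ x in I, ‖α x‖ₑ ^ 2).toReal

theorem normSq_nonneg : 0 ≤ normSq I α := ENNReal.toReal_nonneg

theorem integral_conj_mul_self (hα2 : MemLp α 2 (volume.restrict I)) :
    ∫ x in I, conj (α x) * α x = (normSq I α : ℂ) := by
  have h : ∀ x, conj (α x) * α x = ((‖α x‖ ^ 2 : ℝ) : ℂ) := fun x => by
    rw [mul_comm, Complex.mul_conj, Complex.normSq_eq_norm_sq]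
  simp only [h]
  rw [integral_complex_ofReal, integral_eq_lintegral_of_nonneg_ae
    (Filter.Eventually.of_forall fun x => by positivity) (hα2.1.norm.aemeasurable.pow_const 2).aestronglyMeasurable,
    normSq]
  congr 3
  funext x
  rw [ENNReal.ofReal_pow (norm_nonneg _), ofReal_norm]

theorem sectorAnnih_sectorCreate_zero (f : sector I 0) :
    sectorAnnih hα hα2 0 (sectorCreate hα hα2 0 f) = (normSq I α : ℂ) • f := by
  apply sector_ext
  filter_upwards [wave_sectorAnnih hα hα2 (sectorCreate hα hα2 0 f),
    annih_congr_ae (α := α) (wave_sectorCreate hα hα2 f), wave_smul (normSq I α : ℂ) f]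
    with x h1 h2 h3
  rw [h1, h2, h3, annih_create_zero, integral_conj_mul_self hα2]

theorem sectorAnnih_sectorCreate_succ (f : sector I (n + 1)) :
    sectorAnnih hα hα2 (n + 1) (sectorCreate hα hα2 (n + 1) f) =
      sectorCreate hα hα2 n (sectorAnnih hα hα2 n f) + (normSq I α : ℂ) • f := by
  apply sector_ext
  filter_upwards [wave_sectorAnnih hα hα2 (sectorCreate hα hα2 (n + 1) f),
    annih_congr_ae (α := α) (wave_sectorCreate hα hα2 f), wave_smul (normSq I α : ℂ) f,
    wave_add (sectorCreate hα hα2 n (sectorAnnih hα hα2 n f)) ((normSq I α : ℂ) • f),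
    wave_sectorCreate hα hα2 (sectorAnnih hα hα2 n f),
    create_congr_ae (α := α) (wave_sectorAnnih hα hα2 f),
    annih_create_succ hα2 (isWave_wave f).memLp] with x h1 h2 h3 h4 h5 h6 h7
  rw [h1, h2, h4, h5, h6, h7, h3, integral_conj_mul_self hα2]

theorem norm_sectorAnnih_sq_le (f : sector I (n + 1)) :
    ‖sectorAnnih hα hα2 n f‖ ^ 2 ≤ (n + 1) * normSq I α * ‖f‖ ^ 2 := by
  have h : ‖sectorAnnih hα hα2 n f‖ₑ ^ 2 ≤ (n + 1) * ((∫⁻ x in I, ‖α x‖ₑ ^ 2) * ‖f‖ₑ ^ 2) := by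
    rw [sector_enorm_sq, sector_enorm_sq]
    refine le_trans (le_of_eq (lintegral_congr_ae ?_))
      (lintegral_annih_sq_le hα (isWave_wave f).measurable)
    filter_upwards [wave_sectorAnnih hα hα2 f] with x hx
    rw [hx]
  have hs := lintegral_enorm_sq_ne_top hα2
  have h2 := ENNReal.toReal_mono (by finiteness) h
  simp only [ENNReal.toReal_pow, toReal_enorm, ENNReal.toReal_mul] at h2
  rw [mul_assoc, normSq]
  convert h2 using 2
  rw [ENNReal.toReal_add (by simp) (by simp)]
  simp

end

/-! ### Annihilation and creation operators on vectors with finitely many particles -/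

section

variable {I : Set ℝ} {α : ℝ → ℂ}

/-- A vector with finitely many particles from its components. -/
def finiteVector (f : (n : ℕ) → sector I n) (hf : ∃ N : ℕ, ∀ n, N ≤ n → f n = 0) :
    finiteParticle I :=
  ⟨⟨f, by
    obtain ⟨N, hN⟩ := hf
    refine memℓp_gen (summable_of_ne_finset_zero (s := Finset.range N) fun n hn => ?_)
    rw [hN n (by simpa using hn)]
    simp⟩, hf⟩

theorem finiteParticle_ext {φ χ : finiteParticle I}
    (h : ∀ n, (φ : Fock I) n = (χ : Fock I) n) : φ = χ :=
  Subtype.ext (lp.ext (funext h))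

variable (hα : Measurable α) (hα2 : MemLp α 2 (volume.restrict I))

/-- The annihilation operator of `α`. -/
def annihOp : Module.End ℂ (finiteParticle I) where
  toFun φ := finiteVector (fun n => sectorAnnih hα hα2 n ((φ : Fock I) (n + 1))) (by
    obtain ⟨N, hN⟩ := φ.2
    exact ⟨N, fun n hn => by rw [hN (n + 1) (by omega), map_zero]⟩)
  map_add' φ χ := finiteParticle_ext fun n => map_add (sectorAnnih hα hα2 n) _ _
  map_smul' c φ := finiteParticle_ext fun n => map_smul (sectorAnnih hα hα2 n) _ _

/-- The components of `α† φ`. -/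
def createComponent (φ : Fock I) : (n : ℕ) → sector I n
  | 0 => 0
  | n + 1 => sectorCreate hα hα2 n (φ n)

/-- The creation operator of `α`. -/
def createOp : Module.End ℂ (finiteParticle I) where
  toFun φ := finiteVector (createComponent hα hα2 φ) (by
    obtain ⟨N, hN⟩ := φ.2
    refine ⟨N + 1, fun n hn => ?_⟩
    obtain ⟨m, rfl⟩ : ∃ m, n = m + 1 := ⟨n - 1, by omega⟩
    rw [createComponent, hN m (by omega), map_zero])
  map_add' φ χ := finiteParticle_ext fun n => by
    cases n with
    | zero => exact (add_zero (0 : sector I 0)).symm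
    | succ n => exact map_add (sectorCreate hα hα2 n) _ _
  map_smul' c φ := finiteParticle_ext fun n => by
    cases n with
    | zero => exact (smul_zero (A := sector I 0) c).symm
    | succ n => exact map_smul (sectorCreate hα hα2 n) _ _

theorem annihOp_apply (φ : finiteParticle I) (n : ℕ) :
    (annihOp hα hα2 φ : Fock I) n = sectorAnnih hα hα2 n ((φ : Fock I) (n + 1)) := rfl

theorem createOp_apply_zero (φ : finiteParticle I) :
    (createOp hα hα2 φ : Fock I) 0 = 0 := rfl

theorem createOp_apply_succ (φ : finiteParticle I) (n : ℕ) :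
    (createOp hα hα2 φ : Fock I) (n + 1) = sectorCreate hα hα2 n ((φ : Fock I) n) := rfl

theorem inner_annihOp (φ χ : finiteParticle I) :
    inner ℂ (annihOp hα hα2 φ : Fock I) (χ : Fock I) =
      inner ℂ (φ : Fock I) (createOp hα hα2 χ : Fock I) := by
  have h := (lp.summable_inner (𝕜 := ℂ) (φ : Fock I)
    (createOp hα hα2 χ : Fock I)).tsum_eq_zero_add
  rw [createOp_apply_zero, inner_zero_right, zero_add] at h
  rw [lp.inner_eq_tsum, lp.inner_eq_tsum, h]
  exact tsum_congr fun n => inner_sectorAnnih hα hα2 ((φ : Fock I) (n + 1)) ((χ : Fock I) n)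

theorem inner_createOp (φ χ : finiteParticle I) :
    inner ℂ (createOp hα hα2 φ : Fock I) (χ : Fock I) =
      inner ℂ (φ : Fock I) (annihOp hα hα2 χ : Fock I) := by
  rw [← inner_conj_symm, ← inner_annihOp, inner_conj_symm]

/-- The canonical commutation relation. -/
theorem annihOp_mul_createOp :
    annihOp hα hα2 * createOp hα hα2 =
      createOp hα hα2 * annihOp hα hα2 + (normSq I α : ℂ) • 1 := by
  refine LinearMap.ext fun φ => finiteParticle_ext fun n => ?_
  cases n with
  | zero => exact (sectorAnnih_sectorCreate_zero hα hα2 _).trans (zero_add _).symm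
  | succ n => exact sectorAnnih_sectorCreate_succ hα hα2 _

theorem fock_hasSum_norm_sq (φ : Fock I) : HasSum (fun n => ‖φ n‖ ^ 2) (‖φ‖ ^ 2) := by
  have h := lp.hasSum_norm (p := 2) (by norm_num) φ
  simpa using h

/-- Only components with `n + 1 < N` contribute, so the factor `n + 1` of the sector bound is at
most `N`. -/
theorem norm_annihOp_sq_le (φ : finiteParticle I) {N : ℕ}
    (hN : ∀ n, N ≤ n → (φ : Fock I) n = 0) :
    ‖annihOp hα hα2 φ‖ ^ 2 ≤ N * normSq I α * ‖φ‖ ^ 2 := by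
  have h1 := fock_hasSum_norm_sq (annihOp hα hα2 φ : Fock I)
  have h2 := fock_hasSum_norm_sq (φ : Fock I)
  -- Annihilation reads the component `n + 1`, so the norm series is shifted by one and the vacuum
  -- component drops out.
  have h3 := (hasSum_nat_add_iff' 1).2 h2
  have h4 := h3.mul_left (N * normSq I α)
  have hs := normSq_nonneg (I := I) (α := α)
  refine (hasSum_le (fun n => ?_) h1 h4).trans ?_
  · rw [annihOp_apply]
    by_cases hn : N ≤ n + 1
    · rw [hN _ hn]
      simp
    · refine (norm_sectorAnnih_sq_le hα hα2 _).trans ?_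
      have : (n : ℝ) + 1 ≤ N := by exact_mod_cast (by omega : n + 1 ≤ N)
      gcongr
  · simp only [Finset.range_one, Finset.sum_singleton]
    have : 0 ≤ ‖(φ : Fock I) 0‖ ^ 2 := by positivity
    change _ ≤ (N * normSq I α) * ‖(φ : Fock I)‖ ^ 2
    gcongr
    linarith

/-- `‖cφ‖² = ⟨φ, acφ⟩`, and the commutation relation turns `ac` into `ca + s`. A separate estimate
for creation is thereby avoided. -/
theorem norm_createOp_sq (φ : finiteParticle I) :
    ‖createOp hα hα2 φ‖ ^ 2 = ‖annihOp hα hα2 φ‖ ^ 2 + normSq I α * ‖φ‖ ^ 2 := by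
  have h : inner ℂ (createOp hα hα2 φ : Fock I) (createOp hα hα2 φ : Fock I) =
      inner ℂ (annihOp hα hα2 φ : Fock I) (annihOp hα hα2 φ : Fock I) +
        (normSq I α : ℂ) * inner ℂ (φ : Fock I) (φ : Fock I) := by
    have h2 := LinearMap.congr_fun (annihOp_mul_createOp hα hα2) φ
    simp only [Module.End.mul_apply, LinearMap.add_apply, LinearMap.smul_apply,
      Module.End.one_apply] at h2
    rw [inner_createOp, h2, inner_annihOp, Submodule.coe_add, Submodule.coe_smul,
      inner_add_right, inner_smul_right]
  simp only [inner_self_eq_norm_sq_to_K] at h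
  have h3 : ((‖(createOp hα hα2 φ : Fock I)‖ ^ 2 : ℝ) : ℂ) =
      ((‖(annihOp hα hα2 φ : Fock I)‖ ^ 2 + normSq I α * ‖(φ : Fock I)‖ ^ 2 : ℝ) : ℂ) := by
    push_cast
    exact h
  exact Complex.ofReal_injective h3

/-- The generator `α ψ† - α* ψ` of the displacement operator. -/
def displacementGen : Module.End ℂ (finiteParticle I) := createOp hα hα2 - annihOp hα hα2

theorem inner_displacementGen (φ χ : finiteParticle I) :
    inner ℂ (φ : Fock I) (displacementGen hα hα2 χ : Fock I) =
      -inner ℂ (displacementGen hα hα2 φ : Fock I) (χ : Fock I) := by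
  simp only [displacementGen, LinearMap.sub_apply, Submodule.coe_sub, inner_sub_left,
    inner_sub_right, inner_createOp, inner_annihOp]
  ring

theorem displacementGen_apply_eq_zero {φ : finiteParticle I} {N : ℕ}
    (hN : ∀ n, N ≤ n → (φ : Fock I) n = 0) (n : ℕ) (hn : N + 1 ≤ n) :
    (displacementGen hα hα2 φ : Fock I) n = 0 := by
  obtain ⟨m, rfl⟩ : ∃ m, n = m + 1 := ⟨n - 1, by omega⟩
  change (createOp hα hα2 φ : Fock I) (m + 1) - (annihOp hα hα2 φ : Fock I) (m + 1) = 0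
  rw [createOp_apply_succ, annihOp_apply, hN m (by omega), hN (m + 1 + 1) (by omega)]
  simp

/-- From `‖aφ‖² ≤ N s ‖φ‖²` and `‖cφ‖² ≤ (N + 1) s ‖φ‖²`, using `(u + v)² ≤ 2u² + 2v²` and `2(2N +
1) ≤ 4(N + 1)`. -/
theorem norm_displacementGen_le {φ : finiteParticle I} {N : ℕ}
    (hN : ∀ n, N ≤ n → (φ : Fock I) n = 0) :
    ‖displacementGen hα hα2 φ‖ ≤ 2 * Real.sqrt ((N + 1) * normSq I α) * ‖φ‖ := by
  have hs := normSq_nonneg (I := I) (α := α)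
  have h1 := norm_annihOp_sq_le hα hα2 φ hN
  have h2 := norm_createOp_sq hα hα2 φ
  have h3 : ‖displacementGen hα hα2 φ‖ ≤ ‖createOp hα hα2 φ‖ + ‖annihOp hα hα2 φ‖ :=
    norm_sub_le _ _
  have hb : 0 ≤ 2 * Real.sqrt ((N + 1) * normSq I α) * ‖φ‖ := by positivity
  refine h3.trans (abs_le_of_sq_le_sq' ?_ hb).2
  rw [mul_pow, mul_pow, Real.sq_sqrt (by positivity)]
  have h4 : 0 ≤ normSq I α * ‖φ‖ ^ 2 := by positivity
  nlinarith [sq_nonneg (‖createOp hα hα2 φ‖ - ‖annihOp hα hα2 φ‖)]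

theorem displacementGen_pow_apply_eq_zero {φ : finiteParticle I} {N : ℕ}
    (hN : ∀ n, N ≤ n → (φ : Fock I) n = 0) (k n : ℕ) (hn : N + k ≤ n) :
    ((displacementGen hα hα2 ^ k) φ : Fock I) n = 0 := by
  induction k generalizing n with
  | zero => exact hN n hn
  | succ k ih =>
    rw [pow_succ', Module.End.mul_apply]
    exact displacementGen_apply_eq_zero hα hα2 (N := N + k) ih n (by omega)

theorem summable_norm_displacementGen_pow (φ : finiteParticle I) :
    Summable fun k : ℕ => ‖(k.factorial : ℂ)⁻¹ • (displacementGen hα hα2 ^ k) φ‖ := by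
  obtain ⟨N, hN⟩ := φ.2
  have hs := normSq_nonneg (I := I) (α := α)
  -- For `k ≥ K` this makes the norm of the generator on the `k`-th iterate at most `(k + 1)/2`, so
  -- consecutive terms have ratio at most `1/2`: the condition is `16 s (N + k + 1) ≤ (k + 1)²`, and
  -- `N + k + 1 ≤ (N + 1)(k + 1)`.
  obtain ⟨K, hK⟩ := exists_nat_ge (16 * normSq I α * (N + 1))
  refine summable_of_ratio_norm_eventually_le (r := 1 / 2) (by norm_num) ?_
  filter_upwards [Filter.eventually_ge_atTop K] with k hk
  have h := norm_displacementGen_le hα hα2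
    (displacementGen_pow_apply_eq_zero hα hα2 hN k)
  have hk2 : (K : ℝ) ≤ k := by exact_mod_cast hk
  have h2 : 2 * Real.sqrt (((N + k : ℕ) + 1) * normSq I α) ≤ 1 / 2 * (k + 1) := by
    refine (abs_le_of_sq_le_sq' ?_ (by positivity)).2
    rw [mul_pow, Real.sq_sqrt (by positivity)]
    push_cast
    have h5 : (N : ℝ) + k + 1 ≤ (N + 1) * (k + 1) := by nlinarith [(by positivity : (0 : ℝ) ≤ N * k)]
    have h6 : normSq I α * ((N : ℝ) + k + 1) ≤ normSq I α * ((N + 1) * (k + 1)) := by gcongr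
    nlinarith
  rw [norm_norm, norm_norm, norm_smul, norm_smul, norm_inv, norm_inv, Complex.norm_natCast,
    Complex.norm_natCast, Nat.factorial_succ, pow_succ', Module.End.mul_apply]
  push_cast
  have hf : (0 : ℝ) < k.factorial := by positivity
  calc _ ≤ ((k + 1 : ℝ) * k.factorial)⁻¹ *
        (1 / 2 * (k + 1) * ‖(displacementGen hα hα2 ^ k) φ‖) := by
        gcongr
        exact h.trans (by gcongr)
    _ = _ := by field_simp

end

/-! ### Sums over finite fibers -/

/-- Unconditional sums may be regrouped by any degree function with finite fibers; using two
different degrees on one family is how the exponential and the Dyson series are compared. -/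
theorem hasSum_sum_fiber {ι E : Type*} [AddCommGroup E] [UniformSpace E] [IsUniformAddGroup E]
    [CompleteSpace E] [T2Space E] {f : ι → E} {a : E} (hf : HasSum f a) (deg : ι → ℕ)
    (s : ℕ → Finset ι) (hs : ∀ n k, k ∈ s n ↔ deg k = n) :
    HasSum (fun n => ∑ k ∈ s n, f k) a := by
  have h := hf.tsum_fiberwise deg
  have h2 : ∀ n, deg ⁻¹' {n} = ((s n : Finset ι) : Set ι) := fun n => by
    ext k
    simp [hs]
  convert h using 2 with n
  rw [h2, Finset.tsum_subtype']

/-! ### The exponential of a skew-symmetric operator -/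

section

variable {H : Type*} [NormedAddCommGroup H] [InnerProductSpace ℂ H]

theorem hasSum_inner [CompleteSpace H] {u v : ℕ → H} (hu : Summable fun k => ‖u k‖)
    (hv : Summable fun k => ‖v k‖) :
    HasSum (fun p : ℕ × ℕ => inner ℂ (u p.1) (v p.2)) (inner ℂ (∑' k, u k) (∑' k, v k)) := by
  have hs : Summable fun p : ℕ × ℕ => inner ℂ (u p.1) (v p.2) :=
    (hu.mul_of_nonneg hv (fun _ => norm_nonneg _) (fun _ => norm_nonneg _)).of_norm_bounded
      fun p => norm_inner_le_norm _ _
  have h1 := hs.hasSum.prod_fiberwise (g := fun i => inner ℂ (u i) (∑' k, v k)) fun i =>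
    hv.of_norm.hasSum.mapL (innerSL ℂ (u i))
  have h2 : HasSum (fun i => inner ℂ (u i) (∑' k, v k)) (inner ℂ (∑' k, u k) (∑' k, v k)) := by
    have h3 := hu.of_norm.hasSum.mapL (innerSL ℂ (∑' k, v k))
    have h4 := h3.map (starRingEnd ℂ) Complex.continuous_conj
    simpa [Function.comp_def, inner_conj_symm] using h4
  rw [← h1.unique h2]
  exact hs.hasSum

variable {V : Submodule ℂ H} {X : Module.End ℂ V}

theorem inner_pow_skew (hX : ∀ φ χ : V, inner ℂ (φ : H) (X χ : H) = -inner ℂ (X φ : H) (χ : H))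
    (k : ℕ) (φ χ : V) :
    inner ℂ ((X ^ k) φ : H) (χ : H) = (-1) ^ k * inner ℂ (φ : H) ((X ^ k) χ : H) := by
  induction k generalizing φ χ with
  | zero => simp
  | succ k ih =>
    have h := hX ((X ^ k) φ) χ
    have h2 : (X ^ (k + 1)) φ = X ((X ^ k) φ) := by rw [pow_succ', Module.End.mul_apply]
    have h3 : (X ^ (k + 1)) χ = (X ^ k) (X χ) := by rw [pow_succ, Module.End.mul_apply]
    rw [h2, h3, ← neg_eq_iff_eq_neg.2 h, ih, pow_succ]
    ring

/-- The terms of the exponential series. -/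
def expTerm (X : Module.End ℂ V) (k : ℕ) (φ : V) : V := (k.factorial : ℂ)⁻¹ • (X ^ k) φ

/-- The binomial expansion of `(-1 + 1)^n`, divided by `n!`. -/
theorem sum_antidiagonal_alternating (n : ℕ) :
    ∑ p ∈ Finset.HasAntidiagonal.antidiagonal n,
      ((p.1.factorial : ℂ)⁻¹ * (-1) ^ p.1 * (p.2.factorial : ℂ)⁻¹) = if n = 0 then 1 else 0 := by
  have h := (Commute.all (-1 : ℂ) 1).add_pow' n
  have h2 : ∀ p ∈ Finset.HasAntidiagonal.antidiagonal n,
      ((p.1.factorial : ℂ)⁻¹ * (-1) ^ p.1 * (p.2.factorial : ℂ)⁻¹) =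
        (n.factorial : ℂ)⁻¹ * (n.choose p.1 • ((-1 : ℂ) ^ p.1 * 1 ^ p.2)) := fun p hp => by
    obtain rfl := Finset.HasAntidiagonal.mem_antidiagonal.1 hp
    have h3 := Nat.add_choose_mul_factorial_mul_factorial p.1 p.2
    have h4 : ((p.1 + p.2).choose p.1 : ℂ) * p.1.factorial * p.2.factorial =
      (p.1 + p.2).factorial := by
      rw [Nat.choose_symm_add]
      exact_mod_cast h3
    have h5 : ((p.1 + p.2).factorial : ℂ) ≠ 0 := by exact_mod_cast Nat.factorial_ne_zero _
    have h6 : (p.1.factorial : ℂ) ≠ 0 := by exact_mod_cast Nat.factorial_ne_zero _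
    have h7 : (p.2.factorial : ℂ) ≠ 0 := by exact_mod_cast Nat.factorial_ne_zero _
    rw [nsmul_eq_mul, one_pow, mul_one]
    field_simp
    rw [← h4]
    ring
  rw [Finset.sum_congr rfl h2, ← Finset.mul_sum, ← h]
  rcases n with _ | n <;> simp

/-- The identity `exp(-X) exp(X) = 1` in weak form: moving `X^i` to the right vector costs `(-1)^i`,
and in total degree `n` the coefficients cancel unless `n = 0`. -/
theorem inner_tsum_expTerm [CompleteSpace H]
    (hX : ∀ φ χ : V, inner ℂ (φ : H) (X χ : H) = -inner ℂ (X φ : H) (χ : H))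
    (hs : ∀ φ : V, Summable fun k => ‖expTerm X k φ‖) (φ χ : V) :
    inner ℂ (∑' k, (expTerm X k φ : H)) (∑' k, (expTerm X k χ : H)) =
      inner ℂ (φ : H) (χ : H) := by
  have h := hasSum_sum_fiber (hasSum_inner
    (u := fun k => (expTerm X k φ : H)) (v := fun k => (expTerm X k χ : H)) (hs φ) (hs χ)) (fun p => p.1 + p.2)
    Finset.HasAntidiagonal.antidiagonal fun n p => Finset.HasAntidiagonal.mem_antidiagonal
  refine h.unique ?_
  have h2 : ∀ n : ℕ, ∑ p ∈ Finset.HasAntidiagonal.antidiagonal n,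
      inner ℂ (expTerm X p.1 φ : H) (expTerm X p.2 χ : H) =
        if n = 0 then inner ℂ (φ : H) (χ : H) else 0 := fun n => by
    have h3 : ∀ p ∈ Finset.HasAntidiagonal.antidiagonal n,
        inner ℂ (expTerm X p.1 φ : H) (expTerm X p.2 χ : H) =
          ((p.1.factorial : ℂ)⁻¹ * (-1) ^ p.1 * (p.2.factorial : ℂ)⁻¹) *
            inner ℂ (φ : H) ((X ^ n) χ : H) := fun p hp => by
      obtain rfl := Finset.HasAntidiagonal.mem_antidiagonal.1 hp
      rw [expTerm, expTerm, Submodule.coe_smul, Submodule.coe_smul, inner_smul_left,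
        inner_smul_right, inner_pow_skew hX, pow_add, Module.End.mul_apply]
      simp only [map_inv₀, Complex.conj_natCast]
      ring
    rw [Finset.sum_congr rfl h3, ← Finset.sum_mul, sum_antidiagonal_alternating]
    rcases n with _ | n <;> simp
  simp only [h2]
  exact hasSum_ite_eq 0 _

theorem exists_isometry_exp [CompleteSpace H] (hV : Dense (V : Set H))
    (hX : ∀ φ χ : V, inner ℂ (φ : H) (X χ : H) = -inner ℂ (X φ : H) (χ : H))
    (hs : ∀ φ : V, Summable fun k => ‖expTerm X k φ‖) :
    ∃ U : H →L[ℂ] H, (∀ x, ‖U x‖ = ‖x‖) ∧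
      ∀ φ : V, HasSum (fun k => (expTerm X k φ : H)) (U φ) := by
  have hsum : ∀ φ : V, Summable fun k => (expTerm X k φ : H) := fun φ =>
    Summable.of_norm (f := fun k => (expTerm X k φ : H)) (hs φ)
  let E : V →ₗ[ℂ] H :=
    { toFun := fun φ => ∑' k, (expTerm X k φ : H)
      map_add' := fun φ χ => by
        rw [← (hsum φ).tsum_add (hsum χ)]
        simp [expTerm]
      map_smul' := fun c φ => by
        rw [RingHom.id_apply, ← (hsum φ).tsum_const_smul c]
        simp [expTerm, smul_comm c] }
  have hnorm : ∀ φ : V, ‖E φ‖ = ‖φ‖ := fun φ => by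
    have h := inner_tsum_expTerm hX hs φ φ
    change ‖∑' k, (expTerm X k φ : H)‖ = ‖(φ : H)‖
    rw [@norm_eq_sqrt_re_inner ℂ, h, ← @norm_eq_sqrt_re_inner ℂ]
  have hd : DenseRange V.subtype := by
    rw [DenseRange, Submodule.coe_subtype, Subtype.range_coe]
    exact hV
  have hU : ∀ φ : V, E.extendOfNorm V.subtype (φ : H) = E φ := fun φ =>
    LinearMap.extendOfNorm_eq hd ⟨1, fun φ => by rw [hnorm, one_mul]; rfl⟩ φ
  refine ⟨E.extendOfNorm V.subtype, fun x => ?_, fun φ => ?_⟩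
  · refine hV.induction (P := fun x => ‖E.extendOfNorm V.subtype x‖ = ‖x‖) (fun φ hφ => ?_) ?_ x
    · exact (congrArg norm (hU ⟨φ, hφ⟩)).trans (hnorm ⟨φ, hφ⟩)
    · exact isClosed_eq (by fun_prop) (by fun_prop)
  · rw [hU]
    exact (hsum φ).hasSum

/-- A skew-symmetric operator with summable exponential series generates a unitary. -/
theorem exists_unitary_exp [CompleteSpace H] (hV : Dense (V : Set H))
    (hX : ∀ φ χ : V, inner ℂ (φ : H) (X χ : H) = -inner ℂ (X φ : H) (χ : H))
    (hs : ∀ φ : V, Summable fun k => ‖expTerm X k φ‖) :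
    ∃ U ∈ unitary (H →L[ℂ] H), ∀ φ : V, HasSum (fun k => (expTerm X k φ : H)) (U φ) := by
  have hterm : ∀ k (φ : V), expTerm (-X) k φ = (-1 : ℂ) ^ k • expTerm X k φ := fun k φ => by
    have h : (-X) ^ k = (-1 : ℂ) ^ k • X ^ k := by rw [← smul_pow, neg_one_smul]
    rw [expTerm, expTerm, h, LinearMap.smul_apply, smul_comm]
  obtain ⟨U, hU, hU2⟩ := exists_isometry_exp hV hX hs
  obtain ⟨W, hW, hW2⟩ := exists_isometry_exp (X := -X) hV
    (fun φ χ => by simp [hX]) (fun φ => by simpa [hterm, norm_smul] using hs φ)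
  -- The exponential of `-X` is the adjoint of that of `X`, term by term on `V` and then by density.
  -- Both being isometries, `U†U = 1` and `UU† = 1`.
  have key : ∀ φ χ : V, inner ℂ (W φ) (χ : H) = inner ℂ (φ : H) (U χ) := fun φ χ => by
    have h1 := ((hW2 φ).mapL (innerSL ℂ (χ : H))).map (starRingEnd ℂ) Complex.continuous_conj
    have h2 := (hU2 χ).mapL (innerSL ℂ (φ : H))
    have h3 : ∀ k, inner ℂ (expTerm (-X) k φ : H) (χ : H) =
        inner ℂ (φ : H) (expTerm X k χ : H) := fun k => by
      rw [hterm, expTerm, expTerm]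
      simp only [Submodule.coe_smul, inner_smul_left, inner_smul_right, inner_pow_skew hX,
        map_inv₀, Complex.conj_natCast, map_pow, map_neg, map_one]
      have : ((-1 : ℂ) ^ k) * (-1) ^ k = 1 := by rw [← mul_pow]; simp
      linear_combination ((k.factorial : ℂ)⁻¹ * inner ℂ (φ : H) ((X ^ k) χ : H)) * this
    simp only [Function.comp_def, innerSL_apply_apply, inner_conj_symm, h3] at h1 h2
    exact h1.unique h2
  have hadj : ContinuousLinearMap.adjoint U = W := by
    symm
    rw [ContinuousLinearMap.eq_adjoint_iff]
    intro x y
    refine hV.induction (P := fun x => inner ℂ (W x) y = inner ℂ x (U y)) (fun φ hφ => ?_)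
      (isClosed_eq (by fun_prop) (by fun_prop)) x
    refine hV.induction (P := fun y => inner ℂ (W φ) y = inner ℂ φ (U y)) (fun χ hχ => ?_)
      (isClosed_eq (by fun_prop) (by fun_prop)) y
    exact key ⟨φ, hφ⟩ ⟨χ, hχ⟩
  refine ⟨U, ?_, hU2⟩
  have h1 := U.norm_map_iff_adjoint_comp_self.1 hU
  have h2 := W.norm_map_iff_adjoint_comp_self.1 hW
  rw [← hadj, ContinuousLinearMap.adjoint_adjoint] at h2
  exact Unitary.mem_iff.2 ⟨h1, h2⟩

end

theorem dense_finiteParticle (I : Set ℝ) : Dense (finiteParticle I : Set (Fock I)) := by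
  intro φ
  have h := lp.hasSum_single (p := 2) (by norm_num) φ
  refine mem_closure_of_tendsto h (Filter.Eventually.of_forall fun s => ?_)
  refine Submodule.sum_mem _ fun n _ => ⟨n + 1, fun m hm => ?_⟩
  exact lp.single_apply_ne _ _ _ (by omega)

/-! ### Normal ordering of the exponential -/

/-- The indices `(q, l, r)` with `2 q + l + r = n`. -/
def tripleIndex (n : ℕ) : Finset (ℕ × ℕ × ℕ) :=
  (Finset.range (n + 1) ×ˢ Finset.range (n + 1) ×ˢ Finset.range (n + 1)).filter
    fun k => 2 * k.1 + k.2.1 + k.2.2 = n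

theorem mem_tripleIndex {n : ℕ} {k : ℕ × ℕ × ℕ} :
    k ∈ tripleIndex n ↔ 2 * k.1 + k.2.1 + k.2.2 = n := by
  simp only [tripleIndex, Finset.mem_filter, Finset.mem_product, Finset.mem_range,
    and_iff_right_iff_imp]
  omega

/-- The coefficient of `c ^ l * a ^ r` in the normal ordered exponential. -/
def normalCoeff (s : ℂ) (k : ℕ × ℕ × ℕ) : ℂ :=
  (-(s / 2)) ^ k.1 * (k.1.factorial : ℂ)⁻¹ *
    ((-1) ^ k.2.2 * (k.2.1.factorial : ℂ)⁻¹ * (k.2.2.factorial : ℂ)⁻¹)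

theorem natCast_succ_mul_inv_factorial (n : ℕ) :
    ((n : ℂ) + 1) * ((n + 1).factorial : ℂ)⁻¹ = (n.factorial : ℂ)⁻¹ := by
  have h : (n : ℂ) + 1 ≠ 0 := by exact_mod_cast Nat.succ_ne_zero n
  rw [Nat.factorial_succ]
  push_cast
  rw [mul_inv, mul_inv_cancel_left₀ h]

/-- This recursion and the next two drive both inductions: the expansion of `(c - a)^n` and the
iterated integration of the Dyson series. -/
theorem normalCoeff_q (s : ℂ) (q l r : ℕ) :
    ((q : ℂ) + 1) * normalCoeff s (q + 1, l, r) = -(s / 2) * normalCoeff s (q, l, r) := by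
  simp only [normalCoeff, ← natCast_succ_mul_inv_factorial q]
  ring

theorem normalCoeff_l (s : ℂ) (q l r : ℕ) :
    ((l : ℂ) + 1) * normalCoeff s (q, l + 1, r) = normalCoeff s (q, l, r) := by
  simp only [normalCoeff, ← natCast_succ_mul_inv_factorial l]
  ring

theorem normalCoeff_r (s : ℂ) (q l r : ℕ) :
    ((r : ℂ) + 1) * normalCoeff s (q, l, r + 1) = -normalCoeff s (q, l, r) := by
  simp only [normalCoeff, ← natCast_succ_mul_inv_factorial r]
  ring

section

variable {R : Type*} [Ring R] [Algebra ℂ R] {a c : R} {s : ℂ}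

theorem mul_pow_succ_of_commutator (h : a * c = c * a + s • (1 : R)) (l : ℕ) :
    a * c ^ (l + 1) = c ^ (l + 1) * a + (((l : ℂ) + 1) * s) • c ^ l := by
  induction l with
  | zero => simp [h]
  | succ l ih =>
    rw [pow_succ c (l + 1), ← mul_assoc, ih, add_mul, mul_assoc (c ^ (l + 1)), h, mul_add,
      mul_smul_comm, mul_one, smul_mul_assoc, ← pow_succ, ← mul_assoc, add_assoc, ← add_smul]
    push_cast
    ring_nf

/-- The Baker–Campbell–Hausdorff formula `exp (c - a) = exp (-s/2) exp c exp (-a)`, degree by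
degree. -/
theorem inv_factorial_smul_pow_eq_sum (h : a * c = c * a + s • (1 : R)) (n : ℕ) :
    (n.factorial : ℂ)⁻¹ • (c - a) ^ n =
      ∑ k ∈ tripleIndex n, normalCoeff s k • (c ^ k.2.1 * a ^ k.2.2) := by
  set T : ℕ × ℕ × ℕ → R := fun k => normalCoeff s k • (c ^ k.2.1 * a ^ k.2.2) with hT
  -- The factor `c` raises `l`. Commuting `-a` past `c^l` raises `r` and leaves a commutator term
  -- that lowers `l` and raises `q`; for `l = 0` there is none, hence the case distinction.
  have hstep : ∀ q l r, (c - a) * T (q, l, r) =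
      ((l : ℂ) + 1) • T (q, l + 1, r) + ((r : ℂ) + 1) • T (q, l, r + 1) +
        if l = 0 then 0 else (2 * ((q : ℂ) + 1)) • T (q + 1, l - 1, r) := fun q l r => by
    simp only [hT, smul_smul, normalCoeff_l, normalCoeff_r, sub_mul, mul_smul_comm, mul_assoc,
      normalCoeff_q]
    rcases l with _ | l
    · simp [sub_eq_add_neg, pow_succ']
    · rw [if_neg (Nat.succ_ne_zero l), ← mul_assoc a, mul_pow_succ_of_commutator h, add_mul,
        smul_mul_assoc, ← mul_assoc c, ← pow_succ', mul_assoc (c ^ (l + 1)) a, ← pow_succ',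
        Nat.add_sub_cancel, ← normalCoeff_l s q l r]
      module
  have hl : ∀ n, ∑ k ∈ tripleIndex n, ((k.2.1 : ℂ) + 1) • T (k.1, k.2.1 + 1, k.2.2) =
      ∑ k ∈ tripleIndex (n + 1), (k.2.1 : ℂ) • T k := fun n => by
    refine Finset.sum_of_injOn (fun k => (k.1, k.2.1 + 1, k.2.2)) ?_ ?_ ?_ ?_
    · rintro ⟨q, l, r⟩ _ ⟨q', l', r'⟩ _ h
      simpa using h
    · rintro ⟨q, l, r⟩ hk
      simp only [Finset.mem_coe, mem_tripleIndex] at hk ⊢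
      omega
    · rintro ⟨q, l, r⟩ hk hk2
      rcases l with _ | l
      · simp
      · refine (hk2 ⟨(q, l, r), ?_, rfl⟩).elim
        simp only [Finset.mem_coe, mem_tripleIndex] at hk ⊢
        omega
    · rintro ⟨q, l, r⟩ _
      simp
  have hr : ∀ n, ∑ k ∈ tripleIndex n, ((k.2.2 : ℂ) + 1) • T (k.1, k.2.1, k.2.2 + 1) =
      ∑ k ∈ tripleIndex (n + 1), (k.2.2 : ℂ) • T k := fun n => by
    refine Finset.sum_of_injOn (fun k => (k.1, k.2.1, k.2.2 + 1)) ?_ ?_ ?_ ?_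
    · rintro ⟨q, l, r⟩ _ ⟨q', l', r'⟩ _ h
      simpa using h
    · rintro ⟨q, l, r⟩ hk
      simp only [Finset.mem_coe, mem_tripleIndex] at hk ⊢
      omega
    · rintro ⟨q, l, r⟩ hk hk2
      rcases r with _ | r
      · simp
      · refine (hk2 ⟨(q, l, r), ?_, rfl⟩).elim
        simp only [Finset.mem_coe, mem_tripleIndex] at hk ⊢
        omega
    · rintro ⟨q, l, r⟩ _
      simp
  have hq : ∀ n, ∑ k ∈ tripleIndex n,
      (if k.2.1 = 0 then 0 else (2 * ((k.1 : ℂ) + 1)) • T (k.1 + 1, k.2.1 - 1, k.2.2)) =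
      ∑ k ∈ tripleIndex (n + 1), (2 * (k.1 : ℂ)) • T k := fun n => by
    rcases n with _ | n
    · have h0 : ∀ k ∈ tripleIndex 0, k.2.1 = 0 := fun k hk => by
        rw [mem_tripleIndex] at hk
        omega
      have h1 : ∀ k ∈ tripleIndex (0 + 1), k.1 = 0 := fun k hk => by
        rw [mem_tripleIndex] at hk
        omega
      rw [Finset.sum_eq_zero fun k hk => if_pos (h0 k hk), Finset.sum_eq_zero fun k hk => by
        rw [h1 k hk]
        simp]
    -- The shift `(q, l, r) ↦ (q + 1, l - 1, r)` factors through `(q, l - 1, r)`, two degrees below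
    -- its target. Terms missed by either reindexing vanish.
    trans ∑ k ∈ tripleIndex n, (2 * ((k.1 : ℂ) + 1)) • T (k.1 + 1, k.2.1, k.2.2)
    · symm
      refine Finset.sum_of_injOn (fun k => (k.1, k.2.1 + 1, k.2.2)) ?_ ?_ ?_ ?_
      · rintro ⟨q, l, r⟩ _ ⟨q', l', r'⟩ _ h
        simpa using h
      · rintro ⟨q, l, r⟩ hk
        simp only [Finset.mem_coe, mem_tripleIndex] at hk ⊢
        omega
      · rintro ⟨q, l, r⟩ hk hk2
        rcases l with _ | l
        · simp
        · refine (hk2 ⟨(q, l, r), ?_, rfl⟩).elim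
          simp only [Finset.mem_coe, mem_tripleIndex] at hk ⊢
          omega
      · rintro ⟨q, l, r⟩ _
        simp
    · refine Finset.sum_of_injOn (fun k => (k.1 + 1, k.2.1, k.2.2)) ?_ ?_ ?_ ?_
      · rintro ⟨q, l, r⟩ _ ⟨q', l', r'⟩ _ h
        simpa using h
      · rintro ⟨q, l, r⟩ hk
        simp only [Finset.mem_coe, mem_tripleIndex] at hk ⊢
        omega
      · rintro ⟨q, l, r⟩ hk hk2
        rcases q with _ | q
        · simp
        · refine (hk2 ⟨(q, l, r), ?_, rfl⟩).elim
          simp only [Finset.mem_coe, mem_tripleIndex] at hk ⊢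
          omega
      · rintro ⟨q, l, r⟩ _
        simp
  induction n with
  | zero =>
    have h0 : tripleIndex 0 = {(0, 0, 0)} := by
      ext ⟨q, l, r⟩
      simp only [mem_tripleIndex, Finset.mem_singleton, Prod.mk.injEq]
      omega
    rw [h0]
    simp [hT, normalCoeff]
  | succ n ih =>
    have hn : (n : ℂ) + 1 ≠ 0 := by exact_mod_cast Nat.succ_ne_zero n
    -- After reindexing, each `T k` carries the weight `l + r + 2q`, which equals `n + 1` in this
    -- degree.
    have h1 : ((n : ℂ) + 1) • (((n + 1).factorial : ℂ)⁻¹ • (c - a) ^ (n + 1)) =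
        ((n : ℂ) + 1) • ∑ k ∈ tripleIndex (n + 1), T k := by
      rw [smul_smul, natCast_succ_mul_inv_factorial, pow_succ', ← mul_smul_comm, ih,
        Finset.mul_sum, Finset.sum_congr rfl fun k _ => hstep k.1 k.2.1 k.2.2,
        Finset.sum_add_distrib, Finset.sum_add_distrib, hl, hr, hq, ← Finset.sum_add_distrib,
        ← Finset.sum_add_distrib, Finset.smul_sum]
      refine Finset.sum_congr rfl fun k hk => ?_
      rw [← add_smul, ← add_smul]
      congr 1
      rw [mem_tripleIndex] at hk
      have hk2 : ((2 * k.1 + k.2.1 + k.2.2 : ℕ) : ℂ) = ((n + 1 : ℕ) : ℂ) := by rw [hk]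
      push_cast at hk2
      rw [← hk2]
      ring
    exact (smul_right_injective R hn) h1

end

/-! ### Matrix elements of the displacement operator in normal order. -/

section

variable {I : Set ℝ} {α : ℝ → ℂ} (hα : Measurable α) (hα2 : MemLp α 2 (volume.restrict I))

theorem inner_annihOp_pow (l : ℕ) (φ χ : finiteParticle I) :
    inner ℂ ((annihOp hα hα2 ^ l) φ : Fock I) (χ : Fock I) =
      inner ℂ (φ : Fock I) ((createOp hα hα2 ^ l) χ : Fock I) := by
  induction l generalizing φ χ with
  | zero => rfl
  | succ l ih =>
    rw [pow_succ, Module.End.mul_apply, ih, inner_annihOp, pow_succ', Module.End.mul_apply]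

/-- In normal order the powers of `c` move to the left vector, so only annihilators act and only
finitely many `l` and `r` contribute. -/
theorem inner_expTerm_displacementGen (n : ℕ) (φ χ : finiteParticle I) :
    inner ℂ (φ : Fock I) (expTerm (displacementGen hα hα2) n χ : Fock I) =
      ∑ k ∈ tripleIndex n, normalCoeff (normSq I α) k *
        inner ℂ ((annihOp hα hα2 ^ k.2.1) φ : Fock I) ((annihOp hα hα2 ^ k.2.2) χ : Fock I) := by
  have h := LinearMap.congr_fun (inv_factorial_smul_pow_eq_sum (annihOp_mul_createOp hα hα2) n) χ
  have h2 : expTerm (displacementGen hα hα2) n χ = _ := h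
  rw [h2, LinearMap.sum_apply, Submodule.coe_sum, inner_sum]
  refine Finset.sum_congr rfl fun k _ => ?_
  rw [LinearMap.smul_apply, Submodule.coe_smul, inner_smul_right, Module.End.mul_apply,
    inner_annihOp_pow]

theorem annihOp_pow_apply_eq_zero {φ : finiteParticle I} {N : ℕ}
    (hN : ∀ n, N ≤ n → (φ : Fock I) n = 0) (l n : ℕ) (hn : N ≤ l + n) :
    ((annihOp hα hα2 ^ l) φ : Fock I) n = 0 := by
  induction l generalizing n with
  | zero => exact hN n (by omega)
  | succ l ih =>
    rw [pow_succ', Module.End.mul_apply, annihOp_apply, ih (n + 1) (by omega), map_zero]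

/-- The indices `((q, l, r), t)` with `q + l + r + t = n`. -/
def quadIndex (n : ℕ) : Finset ((ℕ × ℕ × ℕ) × ℕ) :=
  ((Finset.range (n + 1) ×ˢ Finset.range (n + 1) ×ˢ Finset.range (n + 1)) ×ˢ
    Finset.range (n + 1)).filter fun k => k.1.1 + k.1.2.1 + k.1.2.2 + k.2 = n

theorem mem_quadIndex {n : ℕ} {k : (ℕ × ℕ × ℕ) × ℕ} :
    k ∈ quadIndex n ↔ k.1.1 + k.1.2.1 + k.1.2.2 + k.2 = n := by
  simp only [quadIndex, Finset.mem_filter, Finset.mem_product, Finset.mem_range,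
    and_iff_right_iff_imp]
  omega

/-- The matrix elements of the displacement operator, ordered by the total number of factors in
the normal ordered expansion. -/
theorem hasSum_quadIndex {U : Fock I →L[ℂ] Fock I} (φ χ : finiteParticle I)
    (hU : HasSum (fun k => (expTerm (displacementGen hα hα2) k χ : Fock I)) (U χ)) :
    HasSum (fun n => ∑ k ∈ quadIndex n, normalCoeff (normSq I α) k.1 *
        inner ℂ (((annihOp hα hα2 ^ k.1.2.1) φ : Fock I) k.2)
          (((annihOp hα hα2 ^ k.1.2.2) χ : Fock I) k.2))
      (inner ℂ (φ : Fock I) (U χ)) := by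
  set s : ℂ := ((normSq I α : ℝ) : ℂ)
  let u : ℕ → ℂ := fun q => (-(s / 2)) ^ q * (q.factorial : ℂ)⁻¹
  let g : (ℕ × ℕ) × ℕ → ℂ := fun k =>
    ((-1) ^ k.1.2 * (k.1.1.factorial : ℂ)⁻¹ * (k.1.2.factorial : ℂ)⁻¹) *
      inner ℂ (((annihOp hα hα2 ^ k.1.1) φ : Fock I) k.2)
        (((annihOp hα hα2 ^ k.1.2) χ : Fock I) k.2)
  have hu : Summable fun q => ‖u q‖ := by
    refine (NormedSpace.norm_expSeries_div_summable (-(s / 2))).congr fun q => ?_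
    rw [div_eq_mul_inv]
  obtain ⟨N, hN⟩ := φ.2
  obtain ⟨M, hM⟩ := χ.2
  have hg : Summable fun k => ‖g k‖ := by
    refine summable_of_ne_finset_zero
      (s := (Finset.range N ×ˢ Finset.range M) ×ˢ Finset.range N) fun k hk => ?_
    simp only [Finset.mem_product, Finset.mem_range, not_and_or, not_lt] at hk
    rw [norm_eq_zero]
    simp only [g]
    rcases hk with (hk | hk) | hk
    · rw [annihOp_pow_apply_eq_zero hα hα2 hN _ _ (by omega), inner_zero_left, mul_zero]
    · rw [annihOp_pow_apply_eq_zero hα hα2 hM _ _ (by omega), inner_zero_right, mul_zero]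
    · rw [annihOp_pow_apply_eq_zero hα hα2 hN _ _ (by omega), inner_zero_left, mul_zero]
  -- The whole family is the product of an exponential series in `q` and a finitely supported family
  -- in `l, r, t`, hence absolutely summable.
  have h4 := ((Equiv.prodAssoc ℕ (ℕ × ℕ) ℕ).summable_iff.2
    (summable_mul_of_summable_norm hu hg)).hasSum
  have hterm : ∀ k : (ℕ × ℕ × ℕ) × ℕ,
      ((fun x : ℕ × (ℕ × ℕ) × ℕ => u x.1 * g x.2) ∘ Equiv.prodAssoc ℕ (ℕ × ℕ) ℕ) k =
        normalCoeff s k.1 * inner ℂ (((annihOp hα hα2 ^ k.1.2.1) φ : Fock I) k.2)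
          (((annihOp hα hα2 ^ k.1.2.2) χ : Fock I) k.2) := fun k => by
    change u k.1.1 * g (k.1.2, k.2) = _
    simp only [u, g, normalCoeff]
    ring
  rw [funext hterm] at h4
  have h3 := h4.prod_fiberwise (g := fun k => normalCoeff s k *
    inner ℂ ((annihOp hα hα2 ^ k.2.1) φ : Fock I) ((annihOp hα hα2 ^ k.2.2) χ : Fock I))
    fun k => (lp.hasSum_inner ((annihOp hα hα2 ^ k.2.1) φ : Fock I)
        ((annihOp hα hα2 ^ k.2.2) χ : Fock I)).mul_left (normalCoeff s k)
  -- With `t` summed out, grouping by the degree `2q + l + r` in `c - a` recovers the exponential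
  -- series; the last step groups the same family by `q + l + r + t`.
  have h5 := hasSum_sum_fiber h3 (fun k => 2 * k.1 + k.2.1 + k.2.2) tripleIndex
    fun n k => mem_tripleIndex
  simp only [← inner_expTerm_displacementGen, s] at h5
  have h6 := hU.mapL (innerSL ℂ (φ : Fock I))
  simp only [innerSL_apply_apply] at h6
  rw [h6.unique h5]
  exact hasSum_sum_fiber h4 (fun k => k.1.1 + k.1.2.1 + k.1.2.2 + k.2) quadIndex
    fun n k => mem_quadIndex

end

/-! ### Reduction of ordered integrals to the whole configuration space -/

theorem measurableSet_strictAnti (n : ℕ) : MeasurableSet {x : Fin n → ℝ | StrictAnti x} := by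
  have h : {x : Fin n → ℝ | StrictAnti x} =
      ⋂ i, ⋂ j, {x : Fin n → ℝ | i < j → x j < x i} := by
    ext x
    simp only [Set.mem_ofPred_eq, Set.mem_iInter]
    rfl
  rw [h]
  refine MeasurableSet.iInter fun i => MeasurableSet.iInter fun j => ?_
  by_cases hij : i < j
  · simp only [hij, forall_const]
    exact measurableSet_lt (measurable_pi_apply j) (measurable_pi_apply i)
  · simp [hij]

theorem restrict_orderedDomain (I : Set ℝ) (n : ℕ) :
    volume.restrict (orderedDomain I n) =
      (configMeasure I n).restrict {x : Fin n → ℝ | StrictAnti x} := by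
  rw [configMeasure, ← Measure.restrict_pi_pi, Measure.restrict_restrict (measurableSet_strictAnti n),
    ← volume_pi]
  congr 1
  ext x
  simp [orderedDomain, and_comm]

/-- Coinciding coordinates lie on finitely many proper subspaces, which are null sets. -/
theorem ae_injective (I : Set ℝ) (n : ℕ) :
    ∀ᵐ x ∂configMeasure I n, Function.Injective x := by
  have h : ∀ᵐ x : Fin n → ℝ, ∀ i j, i ≠ j → x i ≠ x j := by
    refine ae_all_iff.2 fun i => ae_all_iff.2 fun j => ?_
    by_cases hij : i = j
    · simp [hij]
    let L : (Fin n → ℝ) →ₗ[ℝ] ℝ :=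
      LinearMap.proj (R := ℝ) (φ := fun _ : Fin n => ℝ) i - LinearMap.proj j
    have hL : LinearMap.ker L ≠ ⊤ := fun h => by
      have h2 := LinearMap.congr_fun (LinearMap.ker_eq_top.1 h) (Pi.single i 1)
      simp [L, Ne.symm hij] at h2
    filter_upwards [measure_eq_zero_iff_ae_notMem.1
      (Measure.addHaar_submodule (volume : Measure (Fin n → ℝ)) _ hL)] with x hx _ hxij
    exact hx (by simp [L, hxij])
  rw [configMeasure, ← Measure.restrict_pi_pi, ← volume_pi]
  refine ae_restrict_of_ae ?_
  filter_upwards [h] with x hx i j hij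
  by_contra hne
  exact hx i j hne hij

theorem exists_strictAnti_comp {n : ℕ} {x : Fin n → ℝ} (hx : Function.Injective x) :
    ∃ σ : Equiv.Perm (Fin n), StrictAnti (x ∘ σ) ∧
      ∀ τ : Equiv.Perm (Fin n), StrictAnti (x ∘ τ) → τ = σ := by
  have h1 : Antitone (x ∘ Tuple.sort fun i => -x i) := fun i j hij => by
    have := Tuple.monotone_sort (fun i => -x i) hij
    simpa using this
  refine ⟨Tuple.sort fun i => -x i, h1.strictAnti_of_injective (hx.comp (Equiv.injective _)),
    fun τ hτ => ?_⟩
  have h2 := Tuple.unique_antitone hτ.antitone h1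
  ext i
  exact congrArg Fin.val (hx (congrFun h2 i))

theorem sum_perm_indicator {n : ℕ} {f : (Fin n → ℝ) → ℂ}
    (hf : ∀ (σ : Equiv.Perm (Fin n)) (x : Fin n → ℝ), f (x ∘ σ) = f x) {x : Fin n → ℝ}
    (hx : Function.Injective x) :
    ∑ σ : Equiv.Perm (Fin n), {x : Fin n → ℝ | StrictAnti x}.indicator f (x ∘ σ) = f x := by
  obtain ⟨σ, hσ, hu⟩ := exists_strictAnti_comp hx
  rw [Finset.sum_eq_single σ]
  · rw [Set.indicator_of_mem (by exact hσ), hf]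
  · intro τ _ hτ
    exact Set.indicator_of_notMem (fun h => hτ (hu τ h)) _
  · simp

/-- Off the coincidence set exactly one permutation puts a point in decreasing order; the `n!`
chambers contribute equally for symmetric `f`. -/
theorem integral_config_eq_factorial_mul {I : Set ℝ} {n : ℕ} {f : (Fin n → ℝ) → ℂ}
    (hf : ∀ (σ : Equiv.Perm (Fin n)) (x : Fin n → ℝ), f (x ∘ σ) = f x)
    (hint : Integrable f (configMeasure I n)) :
    ∫ x, f x ∂configMeasure I n = n.factorial * ∫ x in orderedDomain I n, f x := by
  have hS := measurableSet_strictAnti n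
  have hi := hint.indicator hS
  have hmp := measurePreserving_perm I n
  calc ∫ x, f x ∂configMeasure I n
      = ∫ x, ∑ σ : Equiv.Perm (Fin n), {x : Fin n → ℝ | StrictAnti x}.indicator f (x ∘ σ)
          ∂configMeasure I n := by
        refine integral_congr_ae ?_
        filter_upwards [ae_injective I n] with x hx
        rw [sum_perm_indicator hf hx]
    _ = ∑ σ : Equiv.Perm (Fin n), ∫ x, {x : Fin n → ℝ | StrictAnti x}.indicator f x
          ∂configMeasure I n := by
        rw [integral_finsetSum]
        · refine Finset.sum_congr rfl fun σ _ => ?_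
          have h1 := (hmp σ).map_eq
          rw [← integral_map (f := {x : Fin n → ℝ | StrictAnti x}.indicator f)
            (hmp σ).measurable.aemeasurable (by rw [h1]; exact hi.1), h1]
        · exact fun σ _ => (hmp σ).integrable_comp_of_integrable hi
    _ = _ := by
        rw [integral_indicator hS, restrict_orderedDomain, Finset.sum_const, Finset.card_univ,
          Fintype.card_perm, Fintype.card_fin, nsmul_eq_mul]

theorem integrableOn_orderedDomain {I : Set ℝ} {n : ℕ} {f : (Fin n → ℝ) → ℂ}
    (hint : Integrable f (configMeasure I n)) : IntegrableOn f (orderedDomain I n) := by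
  rw [IntegrableOn, restrict_orderedDomain]
  exact hint.restrict

theorem ae_orderedDomain {I : Set ℝ} {n : ℕ} {p : (Fin n → ℝ) → Prop}
    (h : ∀ᵐ x ∂configMeasure I n, p x) : ∀ᵐ x ∂volume.restrict (orderedDomain I n), p x := by
  rw [restrict_orderedDomain]
  exact ae_restrict_of_ae h

/-! ### The Dyson series of the displacement operator as a recursion -/

/-- The matrix elements of `𝔏_{x₁} ⋯ 𝔏_{xₙ} |Ω⟩⟨Ω|` for the generator of the displacement
operator. -/
def dysonList (α : ℝ → ℂ) : List ℝ → WaveFamily → WaveFamily → ℂ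
  | [], φ, χ => vacuumProj φ χ
  | x :: l, φ, χ =>
    -(1 / 2 : ℂ) * (‖α x‖ : ℂ) ^ 2 * dysonList α l φ χ + α x * dysonList α l (ψ x φ) χ +
      -conj (α x) * dysonList α l φ (ψ x χ) + dysonList α l (ψ x φ) (ψ x χ)

theorem vacuumProj_apply (φ χ : WaveFamily) :
    vacuumProj φ χ = conj (φ 0 Fin.elim0) * χ 0 Fin.elim0 := rfl

theorem ψ_apply (x : ℝ) (φ : WaveFamily) (n : ℕ) (y : Fin n → ℝ) :
    ψ x φ n y = (Real.sqrt (n + 1) : ℂ) * φ (n + 1) (Fin.cons x y) := rfl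

theorem list_prod_fin_one {R : Type*} [Semiring R] (l : List (Matrix (Fin 1) (Fin 1) R)) :
    l.prod 0 0 = (l.map fun M => M 0 0).prod := by
  induction l with
  | nil => simp
  | cons M l ih => simp [Matrix.mul_apply, ih]

/-- For `D = 1` trace and matrix product collapse to a product of supermaps. The first one is
outermost and so acts first on the two vectors, which is the recursion in `dysonList`. -/
theorem cmpoDyson_eq_dysonList (α : ℝ → ℂ) (n : ℕ) (x : Fin n → ℝ) (φ χ : WaveFamily) :
    cmpoDyson (D := 1) 1 (fun x => !![-(1 / 2 : ℂ) * (‖α x‖ : ℂ) ^ 2]) (fun x => !![α x])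
      (fun x => !![-conj (α x)]) (fun _ => 1) n x φ χ = dysonList α (List.ofFn x) φ χ := by
  have h : ∀ (l : List ℝ) (φ χ : WaveFamily),
      (l.map fun x => generator (D := 1) (fun x => !![-(1 / 2 : ℂ) * (‖α x‖ : ℂ) ^ 2])
        (fun x => !![α x]) (fun x => !![-conj (α x)]) (fun _ => 1) x 0 0).prod vacuumProj φ χ =
        dysonList α l φ χ := by
    intro l
    induction l with
    | nil => intro φ χ; rfl
    | cons x l ih =>
      intro φ χ
      rw [dysonList, ← ih, ← ih, ← ih, ← ih, List.map_cons, List.prod_cons, Module.End.mul_apply]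
      simp only [generator, bondTensor, Matrix.add_apply, Matrix.map_apply, Matrix.of_apply,
        Matrix.cons_val', Matrix.cons_val_fin_one, Matrix.one_apply_eq,
        one_smul, LinearMap.add_apply, LinearMap.smul_apply, Module.End.one_apply, smul_eq_mul]
      rfl
  rw [← h, cmpoDyson, Matrix.trace_fin_one, Matrix.mul_apply, Fin.sum_univ_one, orderedProd,
    list_prod_fin_one, List.map_ofFn, List.map_ofFn]
  simp [bondTensor, Function.comp_def]

theorem adDyson_eq_dysonList (n : ℕ) (x : Fin n → ℝ) (φ χ : WaveFamily) :
    adDyson n x φ χ = dysonList 0 (List.ofFn x) φ χ := by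
  have h : ∀ (l : List ℝ) (φ χ : WaveFamily),
      (l.map adMap).prod vacuumProj φ χ = dysonList 0 l φ χ := by
    intro l
    induction l with
    | nil => intro φ χ; rfl
    | cons x l ih =>
      intro φ χ
      simp only [dysonList, ← ih, List.map_cons, List.prod_cons, Module.End.mul_apply,
        Pi.zero_apply, norm_zero, map_zero, neg_zero, zero_mul, zero_add, Complex.ofReal_zero,
        ne_eq, OfNat.ofNat_ne_zero, not_false_eq_true, zero_pow, mul_zero]
      rfl
  rw [← h, adDyson, orderedProd, List.map_ofFn]
  rfl

theorem adDyson_eq_adVacuum (n : ℕ) (x : Fin n → ℝ) (φ χ : WaveFamily) :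
    adDyson n x φ χ = adVacuum x φ χ := by
  have h : ∀ (l : List ℝ) (φ χ : WaveFamily), (l.map adMap).prod vacuumProj φ χ =
      vacuumProj (l.foldl (fun χ y => ψ y χ) φ) (l.foldl (fun χ y => ψ y χ) χ) := by
    intro l
    induction l with
    | nil => intro φ χ; rfl
    | cons x l ih =>
      intro φ χ
      rw [List.map_cons, List.prod_cons, Module.End.mul_apply, List.foldl_cons, List.foldl_cons,
        ← ih]
      rfl
  rw [adVacuum, annihilateAll, annihilateAll, ← h, adDyson, orderedProd, List.map_ofFn]
  rfl

/-! ### Symmetry, measurability and choice of representatives in the Dyson integrand. -/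

/-- Families of wave functions that are invariant under permutations. -/
def IsSymm (φ : WaveFamily) : Prop :=
  ∀ n (σ : Equiv.Perm (Fin n)) (x : Fin n → ℝ), φ n (x ∘ σ) = φ n x

theorem IsSymm.ψ {φ : WaveFamily} (hφ : IsSymm φ) (x : ℝ) : IsSymm (ψ x φ) := fun n σ y => by
  rw [ψ_apply, ψ_apply, slice_symm (hφ (n + 1))]

theorem ψ_comm {φ : WaveFamily} (hφ : IsSymm φ) (x y : ℝ) : ψ x (ψ y φ) = ψ y (ψ x φ) := by
  funext n z
  simp only [ψ_apply]
  rw [← hφ (n + 1 + 1) (Equiv.swap 0 1) (Fin.cons x (Fin.cons y z))]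
  congr 3
  funext i
  refine Fin.cases ?_ (fun i => Fin.cases ?_ (fun i => ?_) i) i
  · simp
  · simp
  · rw [Function.comp_apply, Equiv.swap_apply_of_ne_of_ne (Fin.succ_ne_zero _)]
    · simp
    · intro h
      have := congrArg Fin.val h
      simp at this

/-- The generators at two points commute, since their coefficients are scalars and the fields
commute on symmetric families. -/
theorem dysonList_perm (α : ℝ → ℂ) {l l' : List ℝ} (h : l.Perm l') {φ χ : WaveFamily}
    (hφ : IsSymm φ) (hχ : IsSymm χ) : dysonList α l φ χ = dysonList α l' φ χ := by
  induction h generalizing φ χ with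
  | nil => rfl
  | cons x _ ih => simp only [dysonList, ih, hφ, hχ, hφ.ψ, hχ.ψ]
  | swap x y l =>
    simp only [dysonList, ψ_comm hφ y x, ψ_comm hχ y x]
    ring
  | trans _ _ ih1 ih2 => rw [ih1 hφ hχ, ih2 hφ hχ]

theorem dysonList_ofFn_comp_perm (α : ℝ → ℂ) {φ χ : WaveFamily} (hφ : IsSymm φ) (hχ : IsSymm χ)
    {n : ℕ} (σ : Equiv.Perm (Fin n)) (x : Fin n → ℝ) :
    dysonList α (List.ofFn (x ∘ σ)) φ χ = dysonList α (List.ofFn x) φ χ :=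
  dysonList_perm α (σ.ofFn_comp_perm x) hφ hχ

theorem dysonList_congr {α β : ℝ → ℂ} {l : List ℝ} (h : ∀ x ∈ l, α x = β x) (φ χ : WaveFamily) :
    dysonList α l φ χ = dysonList β l φ χ := by
  induction l generalizing φ χ with
  | nil => rfl
  | cons x l ih =>
    simp only [List.mem_cons, forall_eq_or_imp] at h
    simp only [dysonList, ih h.2, h.1]

theorem dysonList_ofFn_cons (α : ℝ → ℂ) {n : ℕ} (x : ℝ) (y : Fin n → ℝ) (φ χ : WaveFamily) :
    dysonList α (List.ofFn (Fin.cons x y : Fin (n + 1) → ℝ)) φ χ =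
      -(1 / 2 : ℂ) * (‖α x‖ : ℂ) ^ 2 * dysonList α (List.ofFn y) φ χ +
        α x * dysonList α (List.ofFn y) (ψ x φ) χ +
        -conj (α x) * dysonList α (List.ofFn y) φ (ψ x χ) +
        dysonList α (List.ofFn y) (ψ x φ) (ψ x χ) := by
  rw [List.ofFn_succ]
  simp only [Fin.cons_zero, Fin.cons_succ, dysonList]

/-- The parameter space `Z` makes the induction work: the recursion replaces `φ` by `ψ x φ`, which
depends on the split-off variable `x`, so joint measurability in parameters is carried along. -/
theorem measurable_dysonList {α : ℝ → ℂ} (hα : Measurable α) {Z : Type} [MeasurableSpace Z]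
    (n : ℕ) {φ χ : Z → WaveFamily}
    (hφ : ∀ k, Measurable fun p : Z × (Fin k → ℝ) => φ p.1 k p.2)
    (hχ : ∀ k, Measurable fun p : Z × (Fin k → ℝ) => χ p.1 k p.2) :
    Measurable fun p : Z × (Fin n → ℝ) => dysonList α (List.ofFn p.2) (φ p.1) (χ p.1) := by
  have hc : Measurable (conj : ℂ → ℂ) := Complex.continuous_conj.measurable
  induction n generalizing Z with
  | zero =>
    have he : Measurable fun p : Z × (Fin 0 → ℝ) => (p.1, (Fin.elim0 : Fin 0 → ℝ)) :=
      measurable_fst.prodMk measurable_const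
    simp only [List.ofFn_zero, dysonList, vacuumProj_apply]
    exact (hc.comp ((hφ 0).comp he)).mul ((hχ 0).comp he)
  | succ n ih =>
    have hψ : ∀ {φ : Z → WaveFamily},
        (∀ k, Measurable fun p : Z × (Fin k → ℝ) => φ p.1 k p.2) →
        ∀ k, Measurable fun p : (Z × ℝ) × (Fin k → ℝ) => ψ p.1.2 (φ p.1.1) k p.2 := by
      intro φ hφ k
      refine measurable_const.mul ((hφ (k + 1)).comp
        (f := fun p : (Z × ℝ) × (Fin k → ℝ) => (p.1.1, (Fin.cons p.1.2 p.2 : Fin (k + 1) → ℝ))) ?_)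
      fun_prop
    have hlift : ∀ {φ : Z → WaveFamily},
        (∀ k, Measurable fun p : Z × (Fin k → ℝ) => φ p.1 k p.2) →
        ∀ k, Measurable fun p : (Z × ℝ) × (Fin k → ℝ) => φ p.1.1 k p.2 := by
      intro φ hφ k
      exact (hφ k).comp (f := fun p : (Z × ℝ) × (Fin k → ℝ) => (p.1.1, p.2)) (by fun_prop)
    have he : Measurable fun p : Z × (Fin (n + 1) → ℝ) => ((p.1, p.2 0), Fin.tail p.2) := by
      refine Measurable.prodMk (by fun_prop) (measurable_pi_lambda _ fun i => ?_)
      simp only [Fin.tail]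
      fun_prop
    have h1 := (ih (Z := Z × ℝ) (φ := fun p => φ p.1) (χ := fun p => χ p.1)
      (hlift hφ) (hlift hχ)).comp he
    have h2 := (ih (Z := Z × ℝ) (φ := fun p => ψ p.2 (φ p.1)) (χ := fun p => χ p.1)
      (hψ hφ) (hlift hχ)).comp he
    have h3 := (ih (Z := Z × ℝ) (φ := fun p => φ p.1) (χ := fun p => ψ p.2 (χ p.1))
      (hlift hφ) (hψ hχ)).comp he
    have h4 := (ih (Z := Z × ℝ) (φ := fun p => ψ p.2 (φ p.1)) (χ := fun p => ψ p.2 (χ p.1))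
      (hψ hφ) (hψ hχ)).comp he
    have key : ∀ p : Z × (Fin (n + 1) → ℝ),
        dysonList α (List.ofFn p.2) (φ p.1) (χ p.1) = _ := fun p => by
      rw [← Fin.cons_self_tail p.2, dysonList_ofFn_cons]
    simp only [key]
    simp only [Function.comp_def] at h1 h2 h3 h4
    have h5 : Measurable fun p : Z × (Fin (n + 1) → ℝ) => α (p.2 0) := by fun_prop
    fun_prop

theorem measurable_dysonList_ofFn {α : ℝ → ℂ} (hα : Measurable α) (n : ℕ) {φ χ : WaveFamily}
    (hφ : ∀ k, Measurable (φ k)) (hχ : ∀ k, Measurable (χ k)) :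
    Measurable fun x : Fin n → ℝ => dysonList α (List.ofFn x) φ χ :=
  (measurable_dysonList hα (Z := Unit) n (φ := fun _ => φ) (χ := fun _ => χ)
    (fun k => (hφ k).comp measurable_snd) (fun k => (hχ k).comp measurable_snd)).comp
    (f := fun x : Fin n → ℝ => ((), x)) (by fun_prop)

theorem measurable_ψ {φ : WaveFamily} (hφ : ∀ k, Measurable (φ k)) (x : ℝ) (k : ℕ) :
    Measurable (ψ x φ k) := by
  have := hφ (k + 1)
  exact measurable_const.mul (this.comp (measurable_cons measurable_const measurable_id))

theorem ψ_ae_congr {I : Set ℝ} {φ φ' : WaveFamily} (h : ∀ k, φ k =ᵐ[configMeasure I k] φ' k) :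
    ∀ᵐ x ∂volume.restrict I, ∀ k, ψ x φ k =ᵐ[configMeasure I k] ψ x φ' k := by
  refine ae_all_iff.2 fun k => ?_
  filter_upwards [ae_config_succ (h (k + 1))] with x hx
  filter_upwards [hx] with y hy
  rw [ψ_apply, ψ_apply, hy]

/-- Although `ψ x` evaluates on a null set, for almost every `x` it respects almost-everywhere
equality. The integrals thus do not depend on the representatives of the vectors. -/
theorem dysonList_ae_congr {I : Set ℝ} {α : ℝ → ℂ} (hα : Measurable α) (n : ℕ)
    {φ φ' χ χ' : WaveFamily} (hφ : ∀ k, Measurable (φ k)) (hφ' : ∀ k, Measurable (φ' k))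
    (hχ : ∀ k, Measurable (χ k)) (hχ' : ∀ k, Measurable (χ' k))
    (h : ∀ k, φ k =ᵐ[configMeasure I k] φ' k) (h' : ∀ k, χ k =ᵐ[configMeasure I k] χ' k) :
    ∀ᵐ x ∂configMeasure I n,
      dysonList α (List.ofFn x) φ χ = dysonList α (List.ofFn x) φ' χ' := by
  induction n generalizing φ φ' χ χ' with
  | zero =>
    filter_upwards [h 0, h' 0] with x h1 h2
    rw [Subsingleton.elim x Fin.elim0] at h1 h2
    simp only [List.ofFn_zero, dysonList, vacuumProj_apply, h1, h2]
  | succ n ih =>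
    refine ae_config_succ_of (measurableSet_eq_fun (measurable_dysonList_ofFn hα _ hφ hχ)
      (measurable_dysonList_ofFn hα _ hφ' hχ')) ?_
    filter_upwards [ψ_ae_congr h, ψ_ae_congr h'] with x hx hx'
    have mφ := measurable_ψ hφ x
    have mφ' := measurable_ψ hφ' x
    have mχ := measurable_ψ hχ x
    have mχ' := measurable_ψ hχ' x
    filter_upwards [ih hφ hφ' hχ hχ' h h', ih mφ mφ' hχ hχ' hx h', ih hφ hφ' mχ mχ' h hx',
      ih mφ mφ' mχ mχ' hx hx'] with y h1 h2 h3 h4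
    rw [dysonList_ofFn_cons, dysonList_ofFn_cons, h1, h2, h3, h4]

section

variable {I : Set ℝ} {α : ℝ → ℂ}

/-! ### Integrability of the Dyson series -/

theorem lintegral_mul_sqrt_le {X : Type*} [MeasurableSpace X] (μ : Measure X)
    {f g : X → ENNReal} (hf : AEMeasurable f μ) (hg : AEMeasurable g μ) :
    ∫⁻ x, f x ^ (1 / 2 : ℝ) * g x ^ (1 / 2 : ℝ) ∂μ ≤
      (∫⁻ x, f x ∂μ) ^ (1 / 2 : ℝ) * (∫⁻ x, g x ∂μ) ^ (1 / 2 : ℝ) := by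
  have h := ENNReal.lintegral_mul_le_Lp_mul_Lq μ Real.HolderConjugate.two_two
    (hf.pow_const (1 / 2 : ℝ)) (hg.pow_const (1 / 2 : ℝ))
  simp only [← ENNReal.rpow_mul] at h
  norm_num at h ⊢
  exact h

theorem lintegral_quadratic {X : Type*} [MeasurableSpace X] (μ : Measure X)
    {A P Q : X → ENNReal} (hA : Measurable A) (hP : Measurable P) (hQ : Measurable Q)
    (C p q : ENNReal) :
    ∫⁻ x, (A x ^ 2 * (C * (p * q)) + A x * (C * (P x * q)) + A x * (C * (p * Q x)) +
        C * (P x * Q x)) ∂μ =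
      C * ((∫⁻ x, A x ^ 2 ∂μ) * (p * q) + (∫⁻ x, A x * P x ∂μ) * q + p * (∫⁻ x, A x * Q x ∂μ) +
        ∫⁻ x, P x * Q x ∂μ) := by
  have h1 : ∀ x, A x * (C * (P x * q)) = A x * P x * (C * q) := fun x => by ring
  have h2 : ∀ x, A x * (C * (p * Q x)) = A x * Q x * (C * p) := fun x => by ring
  simp only [h1, h2]
  rw [lintegral_add_right _ (by fun_prop), lintegral_add_right _ (by fun_prop),
    lintegral_add_right _ (by fun_prop), lintegral_mul_const _ (by fun_prop),
    lintegral_mul_const _ (by fun_prop), lintegral_mul_const _ (by fun_prop),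
    lintegral_const_mul _ (by fun_prop)]
  ring

/-- The sum of the squared norms of the first components of a family of wave functions. -/
def partialNormSq (I : Set ℝ) (n : ℕ) (φ : WaveFamily) : ENNReal :=
  ∑ k ∈ Finset.range (n + 1), ∫⁻ y, ‖φ k y‖ₑ ^ 2 ∂configMeasure I k

theorem partialNormSq_mono (n : ℕ) (φ : WaveFamily) :
    partialNormSq I n φ ≤ partialNormSq I (n + 1) φ :=
  Finset.sum_le_sum_of_subset (Finset.range_mono (by omega))

theorem measurable_partialNormSq_ψ {φ : WaveFamily} (hφ : ∀ k, Measurable (φ k)) (n : ℕ) :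
    Measurable fun x => partialNormSq I n (ψ x φ) := by
  refine Finset.measurable_sum _ fun k _ => ?_
  apply Measurable.lintegral_prod_right' (f := fun p : ℝ × (Fin k → ℝ) => ‖ψ p.1 φ k p.2‖ₑ ^ 2)
  have := hφ (k + 1)
  simp only [ψ_apply]
  fun_prop

/-- The number operator sector by sector: `∫ ‖(ψ(x)φ)ₖ‖² dx = (k + 1) ‖φₖ₊₁‖²` with `k ≤ n`. -/
theorem lintegral_partialNormSq_ψ_le {φ : WaveFamily} (hφ : ∀ k, Measurable (φ k)) (n : ℕ) :
    ∫⁻ x in I, partialNormSq I n (ψ x φ) ≤ (n + 1) * partialNormSq I (n + 1) φ := by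
  have hk : ∀ k, ∫⁻ x in I, ∫⁻ y, ‖ψ x φ k y‖ₑ ^ 2 ∂configMeasure I k =
      (k + 1) * ∫⁻ y, ‖φ (k + 1) y‖ₑ ^ 2 ∂configMeasure I (k + 1) := fun k => by
    have hm := hφ (k + 1)
    have hm2 : Measurable fun p : ℝ × (Fin k → ℝ) => ‖φ (k + 1) (Fin.cons p.1 p.2)‖ₑ ^ 2 := by
      fun_prop
    rw [lintegral_config_succ (by fun_prop), ← lintegral_const_mul _ hm2.lintegral_prod_right']
    refine lintegral_congr fun x => ?_
    have hm3 : Measurable fun y : Fin k → ℝ => ‖φ (k + 1) (Fin.cons x y)‖ₑ ^ 2 := by fun_prop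
    rw [← lintegral_const_mul _ hm3]
    refine lintegral_congr fun y => ?_
    rw [ψ_apply, enorm_mul, mul_pow, enorm_sqrt_succ_sq]
  unfold partialNormSq
  rw [lintegral_finsetSum]
  · simp only [hk]
    rw [Finset.sum_range_succ' _ (n + 1), mul_add, Finset.mul_sum]
    refine le_trans (Finset.sum_le_sum fun k hk => ?_) le_self_add
    gcongr
    simp at hk
    omega
  · intro k _
    apply Measurable.lintegral_prod_right'
      (f := fun p : ℝ × (Fin k → ℝ) => ‖ψ p.1 φ k p.2‖ₑ ^ 2)
    have := hφ (k + 1)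
    simp only [ψ_apply]
    fun_prop

/-- The constant depends on `n`, `α` and `I` but not on the vectors, so the induction hypothesis
applies to `ψ x φ` uniformly in `x`; Cauchy–Schwarz then controls the integral over `x`. -/
theorem exists_lintegral_dysonList_le (hα : Measurable α) (hα2 : MemLp α 2 (volume.restrict I))
    (n : ℕ) : ∃ C : ENNReal, C ≠ ⊤ ∧ ∀ φ χ : WaveFamily, (∀ k, Measurable (φ k)) →
      (∀ k, Measurable (χ k)) →
      ∫⁻ x, ‖dysonList α (List.ofFn x) φ χ‖ₑ ∂configMeasure I n ≤
        C * (partialNormSq I n φ ^ (1 / 2 : ℝ) * partialNormSq I n χ ^ (1 / 2 : ℝ)) := by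
  induction n with
  | zero =>
    refine ⟨1, by simp, fun φ χ hφ hχ => ?_⟩
    have h := lintegral_mul_sqrt_le (configMeasure I 0) (f := fun y => ‖φ 0 y‖ₑ ^ 2)
      (g := fun y => ‖χ 0 y‖ₑ ^ 2) ((hφ 0).enorm.pow_const 2).aemeasurable
      ((hχ 0).enorm.pow_const 2).aemeasurable
    simp only [partialNormSq, zero_add, Finset.range_one, Finset.sum_singleton, one_mul]
    refine le_trans (le_of_eq (lintegral_congr fun y => ?_)) h
    rw [Subsingleton.elim y Fin.elim0, List.ofFn_zero, dysonList, vacuumProj_apply, enorm_mul,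
      RCLike.enorm_conj, ← ENNReal.rpow_natCast, ← ENNReal.rpow_natCast, ← ENNReal.rpow_mul,
      ← ENNReal.rpow_mul]
    norm_num
  | succ n ih =>
    obtain ⟨C, hC, ih⟩ := ih
    set S := ∫⁻ x in I, ‖α x‖ₑ ^ 2 with hS
    have hS2 : S ≠ ⊤ := lintegral_enorm_sq_ne_top hα2
    set N : ℕ → WaveFamily → ENNReal := fun n φ => partialNormSq I n φ ^ (1 / 2 : ℝ) with hN
    have hmono : ∀ φ, N n φ ≤ N (n + 1) φ := fun φ =>
      ENNReal.rpow_le_rpow (partialNormSq_mono n φ) (by norm_num)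
    set r : ENNReal := (n + 1 : ENNReal) ^ (1 / 2 : ℝ) with hr
    have hψ : ∀ φ : WaveFamily, (∀ k, Measurable (φ k)) →
        (∫⁻ x in I, partialNormSq I n (ψ x φ)) ^ (1 / 2 : ℝ) ≤ r * N (n + 1) φ := fun φ hφ => by
      rw [hr, hN, ← ENNReal.mul_rpow_of_nonneg _ _ (by norm_num)]
      exact ENNReal.rpow_le_rpow (lintegral_partialNormSq_ψ_le hφ n) (by norm_num)
    have hsq : ∀ x, ‖α x‖ₑ = (‖α x‖ₑ ^ 2) ^ (1 / 2 : ℝ) := fun x => by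
      rw [← ENNReal.rpow_natCast, ← ENNReal.rpow_mul]
      norm_num
    have hαψ : ∀ φ : WaveFamily, (∀ k, Measurable (φ k)) →
        ∫⁻ x in I, ‖α x‖ₑ * N n (ψ x φ) ≤ S ^ (1 / 2 : ℝ) * (r * N (n + 1) φ) := fun φ hφ => by
      have h := lintegral_mul_sqrt_le (volume.restrict I) (f := fun x => ‖α x‖ₑ ^ 2)
        (g := fun x => partialNormSq I n (ψ x φ)) (hα.enorm.pow_const 2).aemeasurable
        (measurable_partialNormSq_ψ hφ n).aemeasurable
      simp only [← hsq] at h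
      exact h.trans (mul_le_mul_right (hψ φ hφ) _)
    -- One summand for each of `Q`, `L`, `R`, `T`: every `α` costs `√S` and every `ψ x` costs `r =
    -- √(n + 1)`.
    refine ⟨C * (S + S ^ (1 / 2 : ℝ) * r + S ^ (1 / 2 : ℝ) * r + r * r), ?_, fun φ χ hφ hχ => ?_⟩
    · have h1 : S ^ (1 / 2 : ℝ) ≠ ⊤ := ENNReal.rpow_ne_top_of_nonneg (by norm_num) hS2
      have h2 : r ≠ ⊤ := ENNReal.rpow_ne_top_of_nonneg (by norm_num) (by simp)
      finiteness
    have hmψ : ∀ φ : WaveFamily, (∀ k, Measurable (φ k)) → Measurable fun x => N n (ψ x φ) :=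
      fun φ hφ => (measurable_partialNormSq_ψ hφ n).pow_const _
    have mφ := hmψ φ hφ
    have mχ := hmψ χ hχ
    rw [lintegral_config_succ (measurable_dysonList_ofFn hα _ hφ hχ).enorm]
    calc ∫⁻ x in I, ∫⁻ y, ‖dysonList α (List.ofFn (Fin.cons x y : Fin (n + 1) → ℝ)) φ χ‖ₑ
          ∂configMeasure I n
        ≤ ∫⁻ x in I, (‖α x‖ₑ ^ 2 * (C * (N n φ * N n χ)) +
            ‖α x‖ₑ * (C * (N n (ψ x φ) * N n χ)) + ‖α x‖ₑ * (C * (N n φ * N n (ψ x χ))) +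
            C * (N n (ψ x φ) * N n (ψ x χ))) := by
          refine lintegral_mono fun x => ?_
          have xφ := measurable_ψ hφ x
          have xχ := measurable_ψ hχ x
          have m1 := (measurable_dysonList_ofFn hα n hφ hχ).enorm
          have m2 := (measurable_dysonList_ofFn hα n xφ hχ).enorm
          have m3 := (measurable_dysonList_ofFn hα n hφ xχ).enorm
          have m4 := (measurable_dysonList_ofFn hα n xφ xχ).enorm
          calc _ ≤ ∫⁻ y, (‖α x‖ₑ ^ 2 * ‖dysonList α (List.ofFn y) φ χ‖ₑ +
                ‖α x‖ₑ * ‖dysonList α (List.ofFn y) (ψ x φ) χ‖ₑ +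
                ‖α x‖ₑ * ‖dysonList α (List.ofFn y) φ (ψ x χ)‖ₑ +
                ‖dysonList α (List.ofFn y) (ψ x φ) (ψ x χ)‖ₑ) ∂configMeasure I n := by
                refine lintegral_mono fun y => ?_
                rw [dysonList_ofFn_cons]
                refine (enorm_add_le _ _).trans (add_le_add_left ((enorm_add_le _ _).trans
                  (add_le_add ((enorm_add_le _ _).trans (add_le_add ?_ ?_)) ?_)) _)
                · rw [enorm_mul, enorm_mul, enorm_pow, enorm_neg]
                  gcongr
                  have h1 : ‖(1 / 2 : ℂ)‖ₑ ≤ 1 := by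
                    rw [← ofReal_norm]
                    norm_num
                  have h2 : ‖(‖α x‖ : ℂ)‖ₑ = ‖α x‖ₑ := by
                    rw [← ofReal_norm, Complex.norm_real, norm_norm, ofReal_norm]
                  rw [h2]
                  exact mul_le_of_le_one_left' h1
                · rw [enorm_mul]
                · rw [enorm_mul, enorm_neg, RCLike.enorm_conj]
            _ = ‖α x‖ₑ ^ 2 * ∫⁻ y, ‖dysonList α (List.ofFn y) φ χ‖ₑ ∂configMeasure I n +
                ‖α x‖ₑ * ∫⁻ y, ‖dysonList α (List.ofFn y) (ψ x φ) χ‖ₑ ∂configMeasure I n +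
                ‖α x‖ₑ * ∫⁻ y, ‖dysonList α (List.ofFn y) φ (ψ x χ)‖ₑ ∂configMeasure I n +
                ∫⁻ y, ‖dysonList α (List.ofFn y) (ψ x φ) (ψ x χ)‖ₑ ∂configMeasure I n := by
                rw [lintegral_add_right _ m4, lintegral_add_right _ (m3.const_mul _),
                  lintegral_add_right _ (m2.const_mul _), lintegral_const_mul _ m1,
                  lintegral_const_mul _ m2, lintegral_const_mul _ m3]
            _ ≤ _ := by
                gcongr
                · exact ih _ _ hφ hχ
                · exact ih _ _ xφ hχ
                · exact ih _ _ hφ xχ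
                · exact ih _ _ xφ xχ
      _ = C * (S * (N n φ * N n χ) + (∫⁻ x in I, ‖α x‖ₑ * N n (ψ x φ)) * N n χ +
            N n φ * (∫⁻ x in I, ‖α x‖ₑ * N n (ψ x χ)) +
            ∫⁻ x in I, N n (ψ x φ) * N n (ψ x χ)) := by
          exact lintegral_quadratic _ hα.enorm mφ mχ C _ _
      _ ≤ C * (S * (N (n + 1) φ * N (n + 1) χ) +
            (S ^ (1 / 2 : ℝ) * (r * N (n + 1) φ)) * N (n + 1) χ +
            N (n + 1) φ * (S ^ (1 / 2 : ℝ) * (r * N (n + 1) χ)) +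
            (r * N (n + 1) φ) * (r * N (n + 1) χ)) := by
          have h4 := lintegral_mul_sqrt_le (volume.restrict I)
            (measurable_partialNormSq_ψ (I := I) hφ n).aemeasurable
            (measurable_partialNormSq_ψ (I := I) hχ n).aemeasurable
          gcongr
          · exact hmono φ
          · exact hmono χ
          · exact hαψ φ hφ
          · exact hmono χ
          · exact hmono φ
          · exact hαψ χ hχ
          · exact h4.trans (mul_le_mul' (hψ φ hφ) (hψ χ hχ))
      _ = _ := by ring

/-- A family of symmetric wave functions. -/
def IsWaveFamily (I : Set ℝ) (φ : WaveFamily) : Prop := ∀ n, IsWave I n (φ n)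

theorem IsWaveFamily.isSymm {φ : WaveFamily} (hφ : IsWaveFamily I φ) : IsSymm φ :=
  fun n => (hφ n).symm

theorem IsWaveFamily.ψ {φ : WaveFamily} (hφ : IsWaveFamily I φ) :
    ∀ᵐ x ∂volume.restrict I, IsWaveFamily I (ψ x φ) := by
  refine ae_all_iff.2 fun n => ?_
  filter_upwards [(hφ (n + 1)).slice] with x hx
  exact hx.const_mul _

theorem integrable_dysonList (hα : Measurable α) (hα2 : MemLp α 2 (volume.restrict I)) (n : ℕ)
    {φ χ : WaveFamily} (hφ : IsWaveFamily I φ) (hχ : IsWaveFamily I χ) :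
    Integrable (fun x => dysonList α (List.ofFn x) φ χ) (configMeasure I n) := by
  obtain ⟨C, hC, h⟩ := exists_lintegral_dysonList_le hα hα2 n
  refine ⟨(measurable_dysonList_ofFn hα n (fun k => (hφ k).measurable)
    fun k => (hχ k).measurable).aestronglyMeasurable, ?_⟩
  refine (h φ χ (fun k => (hφ k).measurable) fun k => (hχ k).measurable).trans_lt ?_
  have hfin : ∀ {φ}, IsWaveFamily I φ → partialNormSq I n φ ^ (1 / 2 : ℝ) ≠ ⊤ := fun hφ =>
    ENNReal.rpow_ne_top_of_nonneg (by norm_num)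
      (ENNReal.sum_ne_top.2 fun k _ => (hφ k).lintegral_ne_top)
  have h1 := hfin hφ
  have h2 := hfin hχ
  exact (ENNReal.mul_ne_top hC (ENNReal.mul_ne_top h1 h2)).lt_top

end

/-! ### The integrals of the Dyson series -/

/-- Annihilation of a particle with wave function `α`, on families of wave functions. -/
def familyAnnih (I : Set ℝ) (α : ℝ → ℂ) (φ : WaveFamily) : WaveFamily :=
  fun n => annih I α (φ (n + 1))

/-- The inner product of the `n`-particle components. -/
def pairing (I : Set ℝ) (n : ℕ) (φ χ : WaveFamily) : ℂ :=
  ∫ y, conj (φ n y) * χ n y ∂configMeasure I n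

/-- The terms of the normal ordered expansion of the displacement operator. -/
def normalTerm (I : Set ℝ) (α : ℝ → ℂ) (k : (ℕ × ℕ × ℕ) × ℕ) (φ χ : WaveFamily) : ℂ :=
  normalCoeff (normSq I α) k.1 *
    pairing I k.2 ((familyAnnih I α)^[k.1.2.1] φ) ((familyAnnih I α)^[k.1.2.2] χ)

theorem integral_add_four {X : Type*} [MeasurableSpace X] {μ : Measure X} {f g h k : X → ℂ}
    (hf : Integrable f μ) (hg : Integrable g μ) (hh : Integrable h μ) (hk : Integrable k μ) :
    ∫ x, (f x + g x + h x + k x) ∂μ =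
      ∫ x, f x ∂μ + ∫ x, g x ∂μ + ∫ x, h x ∂μ + ∫ x, k x ∂μ := by
  rw [← integral_add hf hg, ← integral_add (f := fun x => f x + g x) (hf.add hg) hh,
    ← integral_add (f := fun x => f x + g x + h x) ((hf.add hg).add hh) hk]

section

variable {I : Set ℝ} {α : ℝ → ℂ}

theorem IsWaveFamily.familyAnnih (hα : Measurable α) (hα2 : MemLp α 2 (volume.restrict I))
    {φ : WaveFamily} (hφ : IsWaveFamily I φ) : IsWaveFamily I (familyAnnih I α φ) :=
  fun n => (hφ (n + 1)).annih hα hα2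

theorem IsWaveFamily.familyAnnih_iterate (hα : Measurable α)
    (hα2 : MemLp α 2 (volume.restrict I)) {φ : WaveFamily} (hφ : IsWaveFamily I φ) (l : ℕ) :
    IsWaveFamily I ((ContinuousMPO.familyAnnih I α)^[l] φ) := by
  induction l with
  | zero => exact hφ
  | succ l ih =>
    rw [Function.iterate_succ_apply']
    exact ih.familyAnnih hα hα2

/-- The smeared form of `ψ_comm`, valid at every point because the two integrands agree everywhere.
-/
theorem familyAnnih_ψ {φ : WaveFamily} (hφ : IsSymm φ) (x : ℝ) :
    familyAnnih I α (ψ x φ) = ψ x (familyAnnih I α φ) := by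
  funext n y
  have h : ∀ z, φ (n + 1 + 1) (Fin.cons x (Fin.cons z y)) =
      φ (n + 1 + 1) (Fin.cons z (Fin.cons x y)) := fun z => by
    have h2 := congrFun (congrFun (ψ_comm hφ z x) n) y
    simp only [ψ_apply] at h2
    exact mul_left_cancel₀ (sqrt_succ_ne_zero _) (mul_left_cancel₀ (sqrt_succ_ne_zero _) h2)
  rw [ψ_apply]
  simp only [familyAnnih, annih]
  congr 1
  rw [← integral_const_mul]
  congr 1
  funext z
  rw [ψ_apply, h]
  ring

theorem familyAnnih_iterate_ψ (hα : Measurable α) (hα2 : MemLp α 2 (volume.restrict I))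
    {φ : WaveFamily} (hφ : IsWaveFamily I φ) (x : ℝ) (l : ℕ) :
    (familyAnnih I α)^[l] (ψ x φ) = ψ x ((familyAnnih I α)^[l] φ) := by
  induction l with
  | zero => rfl
  | succ l ih =>
    rw [Function.iterate_succ_apply', ih, Function.iterate_succ_apply',
      familyAnnih_ψ (hφ.familyAnnih_iterate hα hα2 l).isSymm]

theorem conj_pairing (n : ℕ) (φ χ : WaveFamily) :
    conj (pairing I n φ χ) = pairing I n χ φ := by
  rw [pairing, ← integral_conj]
  simp only [map_mul, Complex.conj_conj, pairing, mul_comm]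

theorem pairing_ψ_left (hα2 : MemLp α 2 (volume.restrict I)) {φ χ : WaveFamily}
    (hφ : IsWaveFamily I φ) (hχ : IsWaveFamily I χ) (n : ℕ) :
    Integrable (fun x => α x * pairing I n (ψ x φ) χ) (volume.restrict I) ∧
      ∫ x in I, α x * pairing I n (ψ x φ) χ = pairing I n (familyAnnih I α φ) χ :=
  ⟨integrable_annih_slice hα2 (hφ (n + 1)).memLp (hχ n).memLp,
    integral_conj_annih_mul hα2 (hφ (n + 1)).memLp (hχ n).memLp⟩

theorem pairing_ψ_right (hα2 : MemLp α 2 (volume.restrict I)) {φ χ : WaveFamily}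
    (hφ : IsWaveFamily I φ) (hχ : IsWaveFamily I χ) (n : ℕ) :
    Integrable (fun x => conj (α x) * pairing I n φ (ψ x χ)) (volume.restrict I) ∧
      ∫ x in I, conj (α x) * pairing I n φ (ψ x χ) = pairing I n φ (familyAnnih I α χ) := by
  obtain ⟨h1, h2⟩ := pairing_ψ_left hα2 hχ hφ n
  have h3 : ∀ x, conj (α x) * pairing I n φ (ψ x χ) = conj (α x * pairing I n (ψ x χ) φ) :=
    fun x => by rw [map_mul, conj_pairing]
  simp only [h3]
  refine ⟨(Complex.conjCLE.integrable_comp_iff).2 h1, ?_⟩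
  rw [integral_conj, h2, conj_pairing]

theorem pairing_ψ_ψ {φ χ : WaveFamily} (hφ : IsWaveFamily I φ) (hχ : IsWaveFamily I χ) (n : ℕ) :
    Integrable (fun x => pairing I n (ψ x φ) (ψ x χ)) (volume.restrict I) ∧
      ∫ x in I, pairing I n (ψ x φ) (ψ x χ) = (n + 1) * pairing I (n + 1) φ χ := by
  have h : Integrable (fun x => conj (φ (n + 1) x) * χ (n + 1) x) (configMeasure I (n + 1)) :=
    (hφ (n + 1)).memLp.star.integrable_mul (hχ (n + 1)).memLp
  have h2 := integrable_config_succ.1 h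
  have h3 : ∀ x, pairing I n (ψ x φ) (ψ x χ) = ((n : ℂ) + 1) *
      ∫ y, conj (φ (n + 1) (Fin.cons x y)) * χ (n + 1) (Fin.cons x y) ∂configMeasure I n :=
    fun x => by
      rw [pairing, ← integral_const_mul]
      refine integral_congr_ae (Filter.Eventually.of_forall fun y => ?_)
      simp only [ψ_apply, map_mul, Complex.conj_ofReal, ← sqrt_succ_mul_self]
      ring
  simp only [h3]
  refine ⟨h2.integral_prod_left.const_mul _, ?_⟩
  rw [integral_const_mul, pairing, integral_config_succ, integral_prod _ h2]

theorem integral_half_normSq (hα2 : MemLp α 2 (volume.restrict I)) :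
    Integrable (fun x => -(1 / 2 : ℂ) * (‖α x‖ : ℂ) ^ 2) (volume.restrict I) ∧
      ∫ x in I, -(1 / 2 : ℂ) * (‖α x‖ : ℂ) ^ 2 = -((normSq I α : ℂ) / 2) := by
  have h : ∀ x, -(1 / 2 : ℂ) * (‖α x‖ : ℂ) ^ 2 = -(1 / 2 : ℂ) * (conj (α x) * α x) := fun x => by
    rw [mul_comm (conj (α x)), Complex.mul_conj, Complex.normSq_eq_norm_sq]
    push_cast
    rfl
  simp only [h]
  refine ⟨(integrable_conj_mul_self hα2).const_mul _, ?_⟩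
  rw [integral_const_mul, integral_conj_mul_self hα2]
  ring

/-- Integrating out one variable: `Q` contributes a factor `-s/2`, `L` an annihilator on the left
vector, `R` one on the right with a minus sign, and `T` passes to the next sector with the factor `t
+ 1`. The recursions for `normalCoeff` turn the first three into raised indices. -/
theorem normalTerm_step (hα : Measurable α) (hα2 : MemLp α 2 (volume.restrict I))
    {φ χ : WaveFamily} (hφ : IsWaveFamily I φ) (hχ : IsWaveFamily I χ) (q l r t : ℕ) :
    Integrable (fun x => -(1 / 2 : ℂ) * (‖α x‖ : ℂ) ^ 2 * normalTerm I α ((q, l, r), t) φ χ +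
        α x * normalTerm I α ((q, l, r), t) (ψ x φ) χ +
        -conj (α x) * normalTerm I α ((q, l, r), t) φ (ψ x χ) +
        normalTerm I α ((q, l, r), t) (ψ x φ) (ψ x χ)) (volume.restrict I) ∧
      ∫ x in I, (-(1 / 2 : ℂ) * (‖α x‖ : ℂ) ^ 2 * normalTerm I α ((q, l, r), t) φ χ +
        α x * normalTerm I α ((q, l, r), t) (ψ x φ) χ +
        -conj (α x) * normalTerm I α ((q, l, r), t) φ (ψ x χ) +
        normalTerm I α ((q, l, r), t) (ψ x φ) (ψ x χ)) =
      ((q : ℂ) + 1) * normalTerm I α ((q + 1, l, r), t) φ χ +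
        ((l : ℂ) + 1) * normalTerm I α ((q, l + 1, r), t) φ χ +
        ((r : ℂ) + 1) * normalTerm I α ((q, l, r + 1), t) φ χ +
        ((t : ℂ) + 1) * normalTerm I α ((q, l, r), t + 1) φ χ := by
  have wφ := hφ.familyAnnih_iterate hα hα2 l
  have wχ := hχ.familyAnnih_iterate hα hα2 r
  obtain ⟨i1, e1⟩ := integral_half_normSq hα2
  obtain ⟨i2, e2⟩ := pairing_ψ_left hα2 wφ wχ t
  obtain ⟨i3, e3⟩ := pairing_ψ_right hα2 wφ wχ t
  obtain ⟨i4, e4⟩ := pairing_ψ_ψ wφ wχ t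
  set s : ℂ := ((normSq I α : ℝ) : ℂ)
  set k := normalCoeff s (q, l, r) with hk
  have j1 := i1.mul_const (normalTerm I α ((q, l, r), t) φ χ)
  have j2 := i2.const_mul k
  have j3 := i3.const_mul (-k)
  have j4 := i4.const_mul k
  have f2 : ∀ x, α x * normalTerm I α ((q, l, r), t) (ψ x φ) χ = k * (α x *
      pairing I t (ψ x ((familyAnnih I α)^[l] φ)) ((familyAnnih I α)^[r] χ)) := fun x => by
    rw [normalTerm, familyAnnih_iterate_ψ hα hα2 hφ]
    ring
  have f3 : ∀ x, -conj (α x) * normalTerm I α ((q, l, r), t) φ (ψ x χ) = -k * (conj (α x) *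
      pairing I t ((familyAnnih I α)^[l] φ) (ψ x ((familyAnnih I α)^[r] χ))) := fun x => by
    rw [normalTerm, familyAnnih_iterate_ψ hα hα2 hχ]
    ring
  have f4 : ∀ x, normalTerm I α ((q, l, r), t) (ψ x φ) (ψ x χ) = k *
      pairing I t (ψ x ((familyAnnih I α)^[l] φ)) (ψ x ((familyAnnih I α)^[r] χ)) := fun x => by
    rw [normalTerm, familyAnnih_iterate_ψ hα hα2 hφ, familyAnnih_iterate_ψ hα hα2 hχ]
  simp only [f2, f3, f4]
  refine ⟨((j1.add j2).add j3).add j4, ?_⟩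
  rw [integral_add_four j1 j2 j3 j4,
    integral_mul_const, e1, integral_const_mul, integral_const_mul, integral_const_mul, e2, e3, e4]
  simp only [normalTerm, Function.iterate_succ_apply']
  linear_combination
    -(pairing I t ((familyAnnih I α)^[l] φ) ((familyAnnih I α)^[r] χ)) * normalCoeff_q s q l r -
    pairing I t (familyAnnih I α ((familyAnnih I α)^[l] φ)) ((familyAnnih I α)^[r] χ) *
      normalCoeff_l s q l r -
    pairing I t ((familyAnnih I α)^[l] φ) (familyAnnih I α ((familyAnnih I α)^[r] χ)) *
      normalCoeff_r s q l r

/-- Each index of level `n + 1` is reached by lowering one of its four entries, with that entry as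
weight; the weights add up to `n + 1`. -/
theorem sum_quadIndex_succ (f : (ℕ × ℕ × ℕ) × ℕ → ℂ) (n : ℕ) :
    ∑ k ∈ quadIndex n, (((k.1.1 : ℂ) + 1) * f ((k.1.1 + 1, k.1.2.1, k.1.2.2), k.2) +
        ((k.1.2.1 : ℂ) + 1) * f ((k.1.1, k.1.2.1 + 1, k.1.2.2), k.2) +
        ((k.1.2.2 : ℂ) + 1) * f ((k.1.1, k.1.2.1, k.1.2.2 + 1), k.2) +
        ((k.2 : ℂ) + 1) * f ((k.1.1, k.1.2.1, k.1.2.2), k.2 + 1)) =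
      ((n : ℂ) + 1) * ∑ k ∈ quadIndex (n + 1), f k := by
  have h : ∀ (w : (ℕ × ℕ × ℕ) × ℕ → ℕ) (e : (ℕ × ℕ × ℕ) × ℕ → (ℕ × ℕ × ℕ) × ℕ),
      Function.Injective e → (∀ k, w (e k) = w k + 1) →
      (∀ k, (e k).1.1 + (e k).1.2.1 + (e k).1.2.2 + (e k).2 =
        k.1.1 + k.1.2.1 + k.1.2.2 + k.2 + 1) →
      (∀ k, w k ≠ 0 → ∃ k', e k' = k) →
      ∑ k ∈ quadIndex n, ((w k : ℂ) + 1) * f (e k) =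
        ∑ k ∈ quadIndex (n + 1), (w k : ℂ) * f k := by
    intro w e he hw hd hs
    refine Finset.sum_of_injOn e he.injOn ?_ ?_ ?_
    · intro k hk
      simp only [Finset.mem_coe, mem_quadIndex] at hk ⊢
      rw [hd, hk]
    · intro k hk hk2
      by_cases h0 : w k = 0
      · simp [h0]
      · obtain ⟨k', rfl⟩ := hs k h0
        refine (hk2 ⟨k', ?_, rfl⟩).elim
        rw [mem_quadIndex, hd] at hk
        simp only [Finset.mem_coe, mem_quadIndex]
        omega
    · intro k _
      rw [hw]
      push_cast
      rfl
  have h1 := h (fun k => k.1.1) (fun k => ((k.1.1 + 1, k.1.2.1, k.1.2.2), k.2))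
    (by rintro ⟨⟨q, l, r⟩, t⟩ ⟨⟨q', l', r'⟩, t'⟩ h; simpa using h) (fun _ => rfl)
    (fun k => by simp only; omega)
    (by rintro ⟨⟨_ | q, l, r⟩, t⟩ h; exacts [(h rfl).elim, ⟨((q, l, r), t), rfl⟩])
  have h2 := h (fun k => k.1.2.1) (fun k => ((k.1.1, k.1.2.1 + 1, k.1.2.2), k.2))
    (by rintro ⟨⟨q, l, r⟩, t⟩ ⟨⟨q', l', r'⟩, t'⟩ h; simpa using h) (fun _ => rfl)
    (fun k => by simp only; omega)
    (by rintro ⟨⟨q, _ | l, r⟩, t⟩ h; exacts [(h rfl).elim, ⟨((q, l, r), t), rfl⟩])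
  have h3 := h (fun k => k.1.2.2) (fun k => ((k.1.1, k.1.2.1, k.1.2.2 + 1), k.2))
    (by rintro ⟨⟨q, l, r⟩, t⟩ ⟨⟨q', l', r'⟩, t'⟩ h; simpa using h) (fun _ => rfl)
    (fun k => by simp only; omega)
    (by rintro ⟨⟨q, l, _ | r⟩, t⟩ h; exacts [(h rfl).elim, ⟨((q, l, r), t), rfl⟩])
  have h4 := h (fun k => k.2) (fun k => ((k.1.1, k.1.2.1, k.1.2.2), k.2 + 1))
    (by rintro ⟨⟨q, l, r⟩, t⟩ ⟨⟨q', l', r'⟩, t'⟩ h; simpa using h) (fun _ => rfl)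
    (fun k => by simp only; omega)
    (by rintro ⟨⟨q, l, r⟩, _ | t⟩ h; exacts [(h rfl).elim, ⟨((q, l, r), t), rfl⟩])
  rw [Finset.sum_add_distrib, Finset.sum_add_distrib, Finset.sum_add_distrib, h1, h2, h3, h4,
    ← Finset.sum_add_distrib, ← Finset.sum_add_distrib, ← Finset.sum_add_distrib, Finset.mul_sum]
  refine Finset.sum_congr rfl fun k hk => ?_
  have hk2 : ((k.1.1 + k.1.2.1 + k.1.2.2 + k.2 : ℕ) : ℂ) = ((n + 1 : ℕ) : ℂ) := by
    rw [mem_quadIndex.1 hk]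
  push_cast at hk2
  rw [← hk2]
  ring

theorem integral_dysonList (hα : Measurable α) (hα2 : MemLp α 2 (volume.restrict I)) (n : ℕ)
    {φ χ : WaveFamily} (hφ : IsWaveFamily I φ) (hχ : IsWaveFamily I χ) :
    ∫ x, dysonList α (List.ofFn x) φ χ ∂configMeasure I n =
      n.factorial * ∑ k ∈ quadIndex n, normalTerm I α k φ χ := by
  induction n generalizing φ χ with
  | zero =>
    have h0 : quadIndex 0 = {((0, 0, 0), 0)} := by
      ext ⟨⟨q, l, r⟩, t⟩
      simp only [mem_quadIndex, Finset.mem_singleton, Prod.mk.injEq]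
      omega
    rw [h0, Finset.sum_singleton, normalTerm]
    simp only [normalCoeff, pow_zero, Nat.factorial_zero, Nat.cast_one, inv_one, mul_one, one_mul,
      Function.iterate_zero, id_eq, pairing]
    refine integral_congr_ae (Filter.Eventually.of_forall fun x => ?_)
    simp only [List.ofFn_zero, dysonList, vacuumProj_apply, Subsingleton.elim x Fin.elim0]
  | succ n ih =>
    have hint := integrable_config_succ.1 (integrable_dysonList hα hα2 (n + 1) hφ hχ)
    have hstep := fun k : (ℕ × ℕ × ℕ) × ℕ =>
      normalTerm_step hα hα2 hφ hχ k.1.1 k.1.2.1 k.1.2.2 k.2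
    rw [integral_config_succ, integral_prod _ hint]
    -- The inner integral over the other `n` variables is given by the induction hypothesis for the
    -- vectors with and without `ψ x`, whose slices are admissible for almost every `x`.
    trans ∫ x in I, (n.factorial : ℂ) * ∑ k ∈ quadIndex n,
        (-(1 / 2 : ℂ) * (‖α x‖ : ℂ) ^ 2 * normalTerm I α k φ χ +
          α x * normalTerm I α k (ψ x φ) χ + -conj (α x) * normalTerm I α k φ (ψ x χ) +
          normalTerm I α k (ψ x φ) (ψ x χ))
    · refine integral_congr_ae ?_
      filter_upwards [hφ.ψ, hχ.ψ] with x xφ xχ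
      have i1 := integrable_dysonList hα hα2 n hφ hχ
      have i2 := integrable_dysonList hα hα2 n xφ hχ
      have i3 := integrable_dysonList hα hα2 n hφ xχ
      have i4 := integrable_dysonList hα hα2 n xφ xχ
      have j1 := i1.const_mul (-(1 / 2 : ℂ) * (‖α x‖ : ℂ) ^ 2)
      have j2 := i2.const_mul (α x)
      have j3 := i3.const_mul (-conj (α x))
      simp only [dysonList_ofFn_cons]
      rw [integral_add_four j1 j2 j3 i4,
        integral_const_mul, integral_const_mul, integral_const_mul, ih hφ hχ, ih xφ hχ, ih hφ xχ,
        ih xφ xχ, Finset.sum_add_distrib, Finset.sum_add_distrib, Finset.sum_add_distrib,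
        ← Finset.mul_sum, ← Finset.mul_sum, ← Finset.mul_sum]
      ring
    · rw [integral_const_mul, integral_finsetSum _ fun k _ => (hstep k).1,
        Finset.sum_congr rfl fun k _ => (hstep k).2,
        sum_quadIndex_succ fun k => normalTerm I α k φ χ, Nat.factorial_succ]
      push_cast
      ring

theorem integral_orderedDomain_dysonList (hα : Measurable α)
    (hα2 : MemLp α 2 (volume.restrict I)) (n : ℕ) {φ χ : WaveFamily} (hφ : IsWaveFamily I φ)
    (hχ : IsWaveFamily I χ) :
    ∫ x in orderedDomain I n, dysonList α (List.ofFn x) φ χ =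
      ∑ k ∈ quadIndex n, normalTerm I α k φ χ := by
  have h := integral_config_eq_factorial_mul
    (fun σ x => dysonList_ofFn_comp_perm α hφ.isSymm hχ.isSymm σ x)
    (integrable_dysonList hα hα2 n hφ hχ)
  rw [integral_dysonList hα hα2 n hφ hχ] at h
  exact (mul_left_cancel₀ (by exact_mod_cast n.factorial_ne_zero) h).symm

end

section

variable {I : Set ℝ} {α β : ℝ → ℂ}

/-! ### Symmetric representatives of Fock vectors -/

/-- The symmetric representatives of the components of a Fock vector. -/
def fockFamily (φ : Fock I) : WaveFamily := fun n => wave (φ n)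

theorem isWaveFamily_fockFamily (φ : Fock I) : IsWaveFamily I (fockFamily φ) :=
  fun n => isWave_wave (φ n)

theorem waves_ae_eq (φ : Fock I) (n : ℕ) :
    waves φ n =ᵐ[configMeasure I n] fockFamily φ n :=
  (wave_ae_eq (φ n)).symm

theorem measurable_waves (φ : Fock I) (n : ℕ) : Measurable (waves φ n) :=
  (Lp.stronglyMeasurable (φ n : Lp ℂ 2 (configMeasure I n))).measurable

theorem pairing_congr_ae {n : ℕ} {φ φ' χ χ' : WaveFamily}
    (h : φ n =ᵐ[configMeasure I n] φ' n) (h' : χ n =ᵐ[configMeasure I n] χ' n) :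
    pairing I n φ χ = pairing I n φ' χ' := by
  refine integral_congr_ae ?_
  filter_upwards [h, h'] with x hx hx'
  rw [hx, hx']

theorem pairing_fockFamily (φ χ : Fock I) (n : ℕ) :
    pairing I n (fockFamily φ) (fockFamily χ) = inner ℂ (φ n) (χ n) :=
  (sector_inner (φ n) (χ n)).symm

theorem familyAnnih_iterate_fockFamily (hα : Measurable α) (hα2 : MemLp α 2 (volume.restrict I))
    (φ : finiteParticle I) (l n : ℕ) :
    (familyAnnih I α)^[l] (fockFamily (φ : Fock I)) n =ᵐ[configMeasure I n]
      fockFamily ((annihOp hα hα2 ^ l) φ : Fock I) n := by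
  induction l generalizing n with
  | zero => exact Filter.EventuallyEq.rfl
  | succ l ih =>
    rw [Function.iterate_succ_apply', pow_succ', Module.End.mul_apply]
    exact (annih_congr_ae (ih (n + 1))).trans (wave_sectorAnnih hα hα2 _).symm

theorem normalTerm_fockFamily (hα : Measurable α) (hα2 : MemLp α 2 (volume.restrict I))
    (φ χ : finiteParticle I) (k : (ℕ × ℕ × ℕ) × ℕ) :
    normalTerm I α k (fockFamily (φ : Fock I)) (fockFamily (χ : Fock I)) =
      normalCoeff (normSq I α) k.1 *
        inner ℂ (((annihOp hα hα2 ^ k.1.2.1) φ : Fock I) k.2)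
          (((annihOp hα hα2 ^ k.1.2.2) χ : Fock I) k.2) := by
  rw [normalTerm, ← pairing_fockFamily]
  congr 1
  exact pairing_congr_ae (familyAnnih_iterate_fockFamily hα hα2 φ _ _)
    (familyAnnih_iterate_fockFamily hα hα2 χ _ _)

/-! ### The Dyson series between Fock vectors -/

/-- The bridge from arbitrary representatives in the definitions to a measurable amplitude and
everywhere symmetric wave functions, for which the integrals were computed. -/
theorem dysonList_waves_ae_eq (hβ : Measurable β) (h : α =ᵐ[volume.restrict I] β) (φ χ : Fock I)
    (n : ℕ) :
    ∀ᵐ x ∂configMeasure I n, dysonList α (List.ofFn x) (waves φ) (waves χ) =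
      dysonList β (List.ofFn x) (fockFamily φ) (fockFamily χ) := by
  have h1 : ∀ᵐ x ∂configMeasure I n, ∀ i, α (x i) = β (x i) :=
    ae_all_iff.2 fun i =>
      (Measure.quasiMeasurePreserving_eval (fun _ : Fin n => volume.restrict I) i).ae h
  filter_upwards [h1, dysonList_ae_congr hβ n (measurable_waves φ)
    (fun k => (isWaveFamily_fockFamily φ k).measurable) (measurable_waves χ)
    (fun k => (isWaveFamily_fockFamily χ k).measurable) (waves_ae_eq φ) (waves_ae_eq χ)]
    with x hx hx2
  rw [← hx2]
  refine dysonList_congr (fun y hy => ?_) _ _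
  obtain ⟨i, rfl⟩ := (List.mem_ofFn' x y).1 hy
  exact hx i

theorem integrableOn_dysonList_waves (hβ : Measurable β) (hβ2 : MemLp β 2 (volume.restrict I))
    (h : α =ᵐ[volume.restrict I] β) (φ χ : Fock I) (n : ℕ) :
    IntegrableOn (fun x => dysonList α (List.ofFn x) (waves φ) (waves χ)) (orderedDomain I n) :=
  integrableOn_orderedDomain ((integrable_dysonList hβ hβ2 n (isWaveFamily_fockFamily φ)
    (isWaveFamily_fockFamily χ)).congr
    ((dysonList_waves_ae_eq hβ h φ χ n).mono fun _ hx => hx.symm))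

theorem integral_dysonList_waves (hβ : Measurable β) (hβ2 : MemLp β 2 (volume.restrict I))
    (h : α =ᵐ[volume.restrict I] β) (φ χ : Fock I) (n : ℕ) :
    ∫ x in orderedDomain I n, dysonList α (List.ofFn x) (waves φ) (waves χ) =
      ∑ k ∈ quadIndex n, normalTerm I β k (fockFamily φ) (fockFamily χ) := by
  rw [← integral_orderedDomain_dysonList hβ hβ2 n (isWaveFamily_fockFamily φ)
    (isWaveFamily_fockFamily χ)]
  exact integral_congr_ae (ae_orderedDomain (dysonList_waves_ae_eq hβ h φ χ n))

/-! ### The identity -/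

theorem memLp_zero_fun : MemLp (0 : ℝ → ℂ) 2 (volume.restrict I) := MemLp.zero

theorem familyAnnih_zero (φ : WaveFamily) : familyAnnih I 0 φ = 0 := by
  funext n y
  simp [familyAnnih, annih]

/-- For `α = 0` both `s` and the annihilator vanish, so only `q = l = r = 0`, `t = n` remains. -/
theorem sum_normalTerm_zero (φ χ : WaveFamily) (n : ℕ) :
    ∑ k ∈ quadIndex n, normalTerm I 0 k φ χ = pairing I n φ χ := by
  have hs : normSq I 0 = 0 := by simp [normSq]
  rw [Finset.sum_eq_single ((0, 0, 0), n)]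
  · simp [normalTerm, normalCoeff]
  · rintro ⟨⟨q, l, r⟩, t⟩ hk hne
    simp only [normalTerm, hs]
    rcases q with _ | q
    · rcases l with _ | l
      · rcases r with _ | r
        · rw [mem_quadIndex] at hk
          simp only [zero_add] at hk
          exact (hne (by rw [hk])).elim
        · rw [Function.iterate_succ_apply', familyAnnih_zero]
          simp [pairing]
      · rw [Function.iterate_succ_apply', familyAnnih_zero]
        simp [pairing]
    · simp [normalCoeff]
  · intro h
    exact (h (mem_quadIndex.2 (by simp))).elim

theorem integral_dysonList_zero (φ χ : Fock I) (n : ℕ) :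
    ∫ x in orderedDomain I n, dysonList 0 (List.ofFn x) (waves φ) (waves χ) =
      inner ℂ (φ n) (χ n) := by
  rw [integral_dysonList_waves measurable_zero memLp_zero_fun Filter.EventuallyEq.rfl,
    sum_normalTerm_zero, pairing_fockFamily]

/-- The projection onto the `n`-particle sector. -/
def sectorProj (I : Set ℝ) (n : ℕ) : Fock I →L[ℂ] Fock I :=
  (lp.singleContinuousLinearMap ℂ (fun n => sector I n) 2 n).comp
    (lp.evalCLM ℂ (fun n => sector I n) 2 n)

theorem inner_sectorProj (φ χ : Fock I) (n : ℕ) :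
    inner ℂ φ (sectorProj I n χ) = inner ℂ (φ n) (χ n) := by
  have h : sectorProj I n χ = lp.single 2 n (χ n) := rfl
  rw [h]
  exact lp.inner_single_right (𝕜 := ℂ) (G := fun n => sector I n) n (χ n) φ

/-- All of Fock space is allowed here because the integrability bound involves only the components
up to `n`. -/
theorem isOrderedIntegral_sectorProj (n : ℕ) :
    IsOrderedIntegral I ⊤ (adDyson n) (sectorProj I n) := by
  intro φ _ χ _
  simp only [adDyson_eq_dysonList]
  exact ⟨integrableOn_dysonList_waves measurable_zero memLp_zero_fun Filter.EventuallyEq.rfl φ χ n,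
    by rw [integral_dysonList_zero, inner_sectorProj]⟩

theorem hasSum_sectorProj (χ : Fock I) : HasSum (fun n => sectorProj I n χ) χ :=
  lp.hasSum_single (by norm_num) χ

theorem isDysonSum_adDyson (I : Set ℝ) : IsDysonSum I adDyson 1 := by
  intro φ _ χ _
  simp only [adDyson_eq_dysonList, integral_dysonList_zero]
  exact ⟨integrableOn_dysonList_waves measurable_zero memLp_zero_fun Filter.EventuallyEq.rfl φ χ,
    lp.hasSum_inner φ χ⟩

theorem cmpoDyson_zero_eq_adDyson (n : ℕ) (x : Fin n → ℝ) (φ χ : WaveFamily) :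
    cmpoDyson (D := 1) 1 (fun _ => 0) (fun _ => 0) (fun _ => 0) (fun _ => 1) n x φ χ =
      adDyson n x φ χ := by
  have h0 : !![(0 : ℂ)] = 0 := by
    ext i j
    simp
  have h := cmpoDyson_eq_dysonList 0 n x φ χ
  simpa [adDyson_eq_dysonList, h0] using h

theorem isCMPU_one (I : Set ℝ) :
    IsCMPU I (D := 1) 1 (fun _ => 0) (fun _ => 0) (fun _ => 0) (fun _ => 1) 1 := by
  refine ⟨fun φ hφ χ hχ => ?_, one_mem _⟩
  simp only [cmpoDyson_zero_eq_adDyson]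
  exact isDysonSum_adDyson I φ hφ χ hχ

/-! ### The displacement operator -/

theorem waveInner_eq_sum {φ χ : WaveFamily} {N : ℕ}
    (h : ∀ n, N ≤ n → φ n =ᵐ[configMeasure I n] 0 ∨ χ n =ᵐ[configMeasure I n] 0) :
    waveInner I φ χ = ∑ n ∈ Finset.range N, pairing I n φ χ := by
  refine tsum_eq_sum fun n hn => ?_
  rw [Finset.mem_range, not_lt] at hn
  refine integral_eq_zero_of_ae ?_
  rcases h n hn with h | h
  · filter_upwards [h] with x hx
    rw [hx]
    simp
  · filter_upwards [h] with x hx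
    rw [hx]
    simp

theorem fock_inner_eq_sum {φ χ : Fock I} {N : ℕ} (h : ∀ n, N ≤ n → φ n = 0 ∨ χ n = 0) :
    inner ℂ φ χ = ∑ n ∈ Finset.range N, inner ℂ (φ n) (χ n) := by
  rw [lp.inner_eq_tsum]
  refine tsum_eq_sum fun n hn => ?_
  rw [Finset.mem_range, not_lt] at hn
  rcases h n hn with h | h
  · rw [h, inner_zero_left]
  · rw [h, inner_zero_right]

theorem waves_ae_eq_zero {φ : Fock I} {n : ℕ} (h : φ n = 0) :
    waves φ n =ᵐ[configMeasure I n] 0 := by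
  refine (waves_ae_eq φ n).trans ?_
  rw [fockFamily, h]
  exact wave_zero

theorem isDisplacementGenerator_displacementGen (hβ : Measurable β)
    (hβ2 : MemLp β 2 (volume.restrict I)) (h : α =ᵐ[volume.restrict I] β) :
    IsDisplacementGenerator I α (displacementGen hβ hβ2) := by
  intro φ χ
  obtain ⟨N, hN⟩ := φ.2
  obtain ⟨M, hM⟩ := χ.2
  set K := max N M
  have hφK : ∀ n, K ≤ n → (φ : Fock I) n = 0 := fun n hn => hN n (le_trans (le_max_left _ _) hn)
  have hχK : ∀ n, K ≤ n → (χ : Fock I) n = 0 := fun n hn => hM n (le_trans (le_max_right _ _) hn)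
  set f := fockFamily (φ : Fock I)
  set g := fockFamily (χ : Fock I)
  have hf : IsWaveFamily I f := isWaveFamily_fockFamily _
  have hg : IsWaveFamily I g := isWaveFamily_fockFamily _
  -- Since both vectors vanish from sector `K` on, the inner products are finite sums, which commute
  -- with the integral over `x`.
  have h1 : ∀ᵐ x ∂volume.restrict I,
      α x * waveInner I (ψ x (waves (φ : Fock I))) (waves (χ : Fock I)) -
        conj (α x) * waveInner I (waves (φ : Fock I)) (ψ x (waves (χ : Fock I))) =
      ∑ n ∈ Finset.range K, β x * pairing I n (ψ x f) g -
        ∑ n ∈ Finset.range K, conj (β x) * pairing I n f (ψ x g) := by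
    filter_upwards [h, ψ_ae_congr (waves_ae_eq (φ : Fock I)),
      ψ_ae_congr (waves_ae_eq (χ : Fock I))] with x hx h2 h3
    rw [hx, waveInner_eq_sum fun n hn => Or.inr (waves_ae_eq_zero (hχK n hn)),
      waveInner_eq_sum fun n hn => Or.inl (waves_ae_eq_zero (hφK n hn)), Finset.mul_sum,
      Finset.mul_sum]
    congr 1
    · exact Finset.sum_congr rfl fun n _ => by
        rw [pairing_congr_ae (h2 n) (waves_ae_eq (χ : Fock I) n)]
    · exact Finset.sum_congr rfl fun n _ => by
        rw [pairing_congr_ae (waves_ae_eq (φ : Fock I) n) (h3 n)]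
  have hl := fun n => pairing_ψ_left hβ2 hf hg n
  have hr := fun n => pairing_ψ_right hβ2 hf hg n
  rw [integral_congr_ae h1, integral_sub (integrable_finsetSum _ fun n _ => (hl n).1)
    (integrable_finsetSum _ fun n _ => (hr n).1), integral_finsetSum _ fun n _ => (hl n).1,
    integral_finsetSum _ fun n _ => (hr n).1]
  simp only [(hl _).2, (hr _).2]
  rw [displacementGen, LinearMap.sub_apply, Submodule.coe_sub, inner_sub_right, ← inner_annihOp,
    fock_inner_eq_sum fun n hn => Or.inr (hχK n hn),
    fock_inner_eq_sum fun n hn => Or.inl (hφK n hn)]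
  congr 1
  · refine Finset.sum_congr rfl fun n _ => ?_
    rw [← pairing_fockFamily]
    exact pairing_congr_ae (familyAnnih_iterate_fockFamily hβ hβ2 φ 1 n).symm
      Filter.EventuallyEq.rfl
  · refine Finset.sum_congr rfl fun n _ => ?_
    rw [← pairing_fockFamily]
    exact pairing_congr_ae Filter.EventuallyEq.rfl
      (familyAnnih_iterate_fockFamily hβ hβ2 χ 1 n).symm

theorem IsDisplacementGenerator.unique {X Y : Module.End ℂ (finiteParticle I)}
    (hX : IsDisplacementGenerator I α X) (hY : IsDisplacementGenerator I α Y) : X = Y := by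
  ext1 χ
  refine ext_inner_left ℂ fun φ => ?_
  exact (hX φ χ).trans (hY φ χ).symm

/-- Matrix elements determine the generator, the generator determines the series, and density
determines the bounded operator. -/
theorem IsDisplacementOperator.unique {U W : Fock I →L[ℂ] Fock I}
    (hU : IsDisplacementOperator I α U) (hW : IsDisplacementOperator I α W) : U = W := by
  obtain ⟨X, hX, hU⟩ := hU
  obtain ⟨Y, hY, hW⟩ := hW
  obtain rfl := hX.unique hY
  refine ContinuousLinearMap.ext fun x => ?_
  refine (dense_finiteParticle I).induction (P := fun x => U x = W x) (fun φ hφ => ?_)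
    (isClosed_eq U.continuous W.continuous) x
  exact (hU ⟨φ, hφ⟩).unique (hW ⟨φ, hφ⟩)

/-- The displacement operators exist and are unitary continuous matrix product operators. -/
theorem exists_isDisplacementOperator (hα : MemLp α 2 (volume.restrict I)) :
    ∃ U : Fock I →L[ℂ] Fock I, IsDisplacementOperator I α U ∧
      IsCMPU I (D := 1) 1 (fun x => !![-(1 / 2 : ℂ) * (‖α x‖ : ℂ) ^ 2]) (fun x => !![α x])
        (fun x => !![-conj (α x)]) (fun _ => 1) U := by
  -- `α` is only almost everywhere equal to a measurable function; all operators are built from the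
  -- measurable representative `β`.
  obtain ⟨β, hβ, h⟩ := hα.1
  have hβ2 : MemLp β 2 (volume.restrict I) := (memLp_congr_ae h).1 hα
  have hβm := hβ.measurable
  obtain ⟨U, hU, hexp⟩ := exists_unitary_exp (dense_finiteParticle I)
    (inner_displacementGen hβm hβ2) (summable_norm_displacementGen_pow hβm hβ2)
  refine ⟨U, ⟨displacementGen hβm hβ2, isDisplacementGenerator_displacementGen hβm hβ2 h, hexp⟩,
    fun φ hφ χ hχ => ?_, hU⟩
  simp only [cmpoDyson_eq_dysonList, integral_dysonList_waves hβm hβ2 h]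
  refine ⟨integrableOn_dysonList_waves hβm hβ2 h φ χ, ?_⟩
  have hs := hasSum_quadIndex hβm hβ2 ⟨φ, hφ⟩ ⟨χ, hχ⟩ (hexp ⟨χ, hχ⟩)
  simp only [← normalTerm_fockFamily] at hs
  exact hs

end

end ContinuousMPO

end

theorem mainTheorem10 (I : Set ℝ) (hI : I.OrdConnected) :
    -- each term of the Dyson series is `ψ†(x₁) ⋯ ψ†(xₙ) |Ω⟩⟨Ω| ψ(xₙ) ⋯ ψ(x₁)`
    (∀ (n : ℕ) (x : Fin n → ℝ) (φ χ : ContinuousMPO.WaveFamily),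
      ContinuousMPO.adDyson n x φ χ = ContinuousMPO.adVacuum x φ χ) ∧
    -- the path-ordered exponential of `Ad_x` applied to `|Ω⟩⟨Ω|` is the identity: its terms are
    -- bounded operators, whose series converges strongly to the identity
    (∃ P : ℕ → (ContinuousMPO.Fock I →L[ℂ] ContinuousMPO.Fock I),
      (∀ n, ContinuousMPO.IsOrderedIntegral I ⊤ (ContinuousMPO.adDyson n) (P n)) ∧
      ∀ χ, HasSum (fun n => P n χ) χ) ∧
    ContinuousMPO.IsDysonSum I ContinuousMPO.adDyson 1 ∧
    -- the identity is a cMPU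
    ContinuousMPO.IsCMPU I (D := 1) 1 (fun _ => 0) (fun _ => 0) (fun _ => 0) (fun _ => 1) 1 ∧
    -- the displacement operators exist, are uniquely determined, and are cMPUs
    ∀ α : ℝ → ℂ, MeasureTheory.MemLp α 2 (MeasureTheory.volume.restrict I) →
      (∃! U, ContinuousMPO.IsDisplacementOperator I α U) ∧
      ∀ U, ContinuousMPO.IsDisplacementOperator I α U →
        ContinuousMPO.IsCMPU I (D := 1) 1
          (fun x => !![-(1 / 2 : ℂ) * (‖α x‖ : ℂ) ^ 2]) (fun x => !![α x])
          (fun x => !![-(starRingEnd ℂ) (α x)]) (fun _ => 1) U := by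
  refine ⟨ContinuousMPO.adDyson_eq_adVacuum,
    ⟨ContinuousMPO.sectorProj I, ContinuousMPO.isOrderedIntegral_sectorProj,
      ContinuousMPO.hasSum_sectorProj⟩,
    ContinuousMPO.isDysonSum_adDyson I, ContinuousMPO.isCMPU_one I, fun α hα => ?_⟩
  obtain ⟨U, hU, hcmpu⟩ := ContinuousMPO.exists_isDisplacementOperator hα
  exact ⟨⟨U, hU, fun W hW => hW.unique hU⟩, fun W hW => hW.unique hU ▸ hcmpu⟩
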